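/- Let $A$ be a principal ideal domain with fraction field $K$, let $\mathfrak p=\pi A$ be a nonzero maximal ideal whose residue field $k=A/\mathfrak p$ is perfect, and let $v$ be the normalized $\mathfrak p$-adic valuation. Let $C$ be a hyperelliptic curve of genus $g\ge 1$ over $K$ (smooth and projective; an elliptic curve if $g=1$) with a rational Weierstrass point $w_0$. **Definitions.** A Weierstrass equation of $C$ over $A$ (resp. $A_{\mathfrak p}$) is an equation $y^2+Q(x)y=P(x)$, where $x,y$ generate the function field of $C$ and $Q,P$ are polynomials over $A$ (resp. $A_{\mathfrak p}$) with $\deg Q\le g+1$, $\deg P\le 2g+2$, whose discriminant $\Delta$ is nonzero. Here $\Delta=2^{-4(g+1)}\operatorname{disc}_{2g+2}(4P+Q^2)$, a polynomial with integer coefficients in the coefficients of $Q$ and $P$, where $\operatorname{disc}_{2g+2}$ is the discriminant in formal degree $2g+2$. The equation is a pointed equation of $(C,w_0)$ if $\deg Q\le g$, $P$ is monic of degree $2g+1$ and $w_0$ is the pole of $x$. A pointed equation over $A$ is pointed-minimal at $\mathfrak p$ if $v(\Delta)$ is the smallest among all pointed equations of $(C,w_0)$ over $A_{\mathfrak p}$.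 Let $W$ be the Weierstrass model defined by an equation over $A$, and let $W_0(k)=\{(\bar c,\bar d)\in k^2 : \bar d^2+\bar Q(\bar c)\bar d=\bar P(\bar c)\}$ be the set of $k$-points of its affine chart $W_0=\operatorname{Spec}A[x,y]/(y^2+Q(x)y-P(x))$. For $c\in A$ and $H=\sum_i a_i(x-c)^i\in A[x]$ put $\mu_c(H)=\min_i\{v(a_i)+i\}$. For $p_0\in W_0(k)$ with $x$-coordinate $\bar c$, the class of $c\in A$, put $$\lambda(p_0)=\max_{H\in A[x]}\min\{2\mu_c(Q-2H),\ \mu_c(P+QH-H^2)\}.$$ Let $r=\lfloor\lambda(p_0)/2\rfloor$ and choose $H$ of degree at most $g+1$ attaining this maximum. The dilatation $W(p_0)$ is the Weierstrass model with coordinates $x_1,y_1$ given by $x=\pi x_1+c$, $y+H(x)=\pi^r y_1$, and with equation $$y_1^2+\pi^{-r}(Q-2H)(\pi x_1+c)\,y_1=\pi^{-2r}(P+QH-H^2)(\pi x_1+c).$$ **Statement.** Let $y^2+Q(x)y=P(x)$ be a pointed Weierstrass equation of $(C,w_0)$ over $A$, with discriminant $\Delta$ and associated model $W$. This equation is not pointed-minimal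 at $\mathfrak p$ if and only if there exist $p_0\in W_0(k)$ with $\lambda(p_0)=2g+1$ and $q_0\in W(p_0)_0(k)$ with $\lambda(q_0)=2g+2$. Moreover, for any such $p_0$ and $q_0$, the model $W(p_0)(q_0)$ is defined by a pointed Weierstrass equation of $(C,w_0)$ over $A$, and $$v(\Delta_{W(p_0)(q_0)})=v(\Delta)-4g(2g+1).$$ -/

import Mathlib

open Polynomial

namespace Hyperelliptic

/-! ### The discriminant of `y² + Q(x) y = P(x)`

`Δ = 2^{-4(g+1)} disc (4P + Q²)`, where the discriminant is that of a polynomial of formal degree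
`2g+2`.  It is a polynomial with integer coefficients in the coefficients of `Q` and `P`, and is
therefore defined over every commutative ring.  The variable `Sum.inl i` stands for the `i`-th
coefficient of `Q`, and `Sum.inr i` for the `i`-th coefficient of `P`. -/

/-- The generic polynomial `Q` of degree `g + 1`. -/
noncomputable def genericQ (g : ℕ) : (MvPolynomial (ℕ ⊕ ℕ) ℤ)[X] :=
  ∑ i ∈ Finset.range (g + 2), C (MvPolynomial.X (Sum.inl i)) * X ^ i

/-- The generic polynomial `P` of degree `2g + 2`. -/
noncomputable def genericP (g : ℕ) : (MvPolynomial (ℕ ⊕ ℕ) ℤ)[X] :=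
  ∑ i ∈ Finset.range (2 * g + 3), C (MvPolynomial.X (Sum.inr i)) * X ^ i

/-- The generic polynomial `4P + Q²`, of degree `2g + 2`. -/
noncomputable def genericF (g : ℕ) : (MvPolynomial (ℕ ⊕ ℕ) ℤ)[X] :=
  4 * genericP g + genericQ g ^ 2

theorem genericQ_coeff (g i : ℕ) (hi : i < g + 2) :
    (genericQ g).coeff i = MvPolynomial.X (Sum.inl i) := by
  simp [genericQ, coeff_X_pow, hi]

theorem genericP_coeff (g i : ℕ) (hi : i < 2 * g + 3) :
    (genericP g).coeff i = MvPolynomial.X (Sum.inr i) := by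
  simp [genericP, coeff_X_pow, hi]

theorem genericQ_natDegree_le (g : ℕ) : (genericQ g).natDegree ≤ g + 1 := by
  refine natDegree_sum_le_of_forall_le _ _ fun i hi => ?_
  have := Finset.mem_range.mp hi
  exact (natDegree_C_mul_X_pow_le _ _).trans (by omega)

theorem genericP_natDegree_le (g : ℕ) : (genericP g).natDegree ≤ 2 * g + 2 := by
  refine natDegree_sum_le_of_forall_le _ _ fun i hi => ?_
  have := Finset.mem_range.mp hi
  exact (natDegree_C_mul_X_pow_le _ _).trans (by omega)

theorem genericF_natDegree_le (g : ℕ) : (genericF g).natDegree ≤ 2 * g + 2 := by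
  refine natDegree_add_le_of_degree_le ?_ ?_
  · refine natDegree_mul_le.trans ?_
    have : (4 : (MvPolynomial (ℕ ⊕ ℕ) ℤ)[X]).natDegree = 0 := natDegree_ofNat 4
    have := genericP_natDegree_le g
    omega
  · refine natDegree_pow_le.trans ?_
    have := genericQ_natDegree_le g
    omega

theorem genericF_coeff (g : ℕ) : (genericF g).coeff (2 * g + 2) =
    4 * MvPolynomial.X (Sum.inr (2 * g + 2)) + MvPolynomial.X (Sum.inl (g + 1)) ^ 2 := by
  have h4 : (4 : (MvPolynomial (ℕ ⊕ ℕ) ℤ)[X]) = C 4 := (map_ofNat C 4).symm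
  have h2 : 2 * g + 2 = 2 * (g + 1) := by ring
  rw [genericF, coeff_add, h4, coeff_C_mul, genericP_coeff _ _ (by omega)]
  congr 1
  rw [h2, coeff_pow_of_natDegree_le (genericQ_natDegree_le g), genericQ_coeff _ _ (by omega)]

theorem not_two_dvd_genericF_coeff (g : ℕ) :
    ¬ (2 : MvPolynomial (ℕ ⊕ ℕ) ℤ) ∣ (genericF g).coeff (2 * g + 2) := by
  rintro ⟨d, hd⟩
  rw [genericF_coeff] at hd
  have := congrArg (MvPolynomial.eval (Sum.elim (fun _ => (1 : ℤ)) (fun _ => 0))) hd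
  simp at this
  omega

theorem genericF_natDegree (g : ℕ) : (genericF g).natDegree = 2 * g + 2 := by
  refine le_antisymm (genericF_natDegree_le g) (le_natDegree_of_ne_zero fun h => ?_)
  exact not_two_dvd_genericF_coeff g (h ▸ dvd_zero _)

theorem prime_two : Prime (2 : MvPolynomial (ℕ ⊕ ℕ) ℤ) := by
  have h := (MvPolynomial.prime_C_iff (ℕ ⊕ ℕ) (R := ℤ) (r := 2)).mpr Int.prime_two
  simpa using h

theorem two_pow_dvd_discr (g : ℕ) :
    (2 : MvPolynomial (ℕ ⊕ ℕ) ℤ) ^ (4 * (g + 1)) ∣ (genericF g).discr := by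
  set F := genericF g with hF
  set P := genericP g with hP
  set Q := genericQ g with hQ
  have hdegF : F.natDegree = 2 * g + 2 := genericF_natDegree g
  have hdegF' : (derivative F).natDegree = 2 * g + 1 := by
    rw [natDegree_derivative, hdegF]; omega
  have hsq : derivative F * derivative F =
      C 16 * (derivative P ^ 2 + derivative P * Q * derivative Q - P * derivative Q ^ 2) +
        F * (4 * derivative Q ^ 2) := by
    have h16 : (C 16 : (MvPolynomial (ℕ ⊕ ℕ) ℤ)[X]) = 16 := map_ofNat C 16
    have hd : derivative F = 4 * derivative P + 2 * Q * derivative Q := by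
      rw [hF, genericF, ← hP, ← hQ]
      have h4 : (4 : (MvPolynomial (ℕ ⊕ ℕ) ℤ)[X]) = C 4 := (map_ofNat C 4).symm
      rw [derivative_add, h4, derivative_C_mul, sq, derivative_mul]
      ring
    rw [hd, h16, hF, genericF, ← hP, ← hQ]
    ring
  have hdQ : (derivative Q).natDegree ≤ g :=
    (natDegree_derivative_le _).trans (by have : Q.natDegree ≤ g + 1 := genericQ_natDegree_le g
                                          omega)
  have hmul := resultant_mul_right F (derivative F) (derivative F) _ le_rfl
  have h4 : (4 * derivative Q ^ 2).natDegree ≤ 2 * g := by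
    refine natDegree_mul_le.trans ?_
    have h0 : (4 : (MvPolynomial (ℕ ⊕ ℕ) ℤ)[X]).natDegree = 0 := natDegree_ofNat 4
    have := natDegree_pow_le (p := derivative Q) (n := 2)
    omega
  rw [hsq, resultant_add_mul_right _ _ _ _ _ (by omega) le_rfl, resultant_C_mul_right] at hmul
  have hres := resultant_deriv (f := F) (natDegree_pos_iff_degree_pos.mp (by omega))
  rw [show F.natDegree - 1 = (derivative F).natDegree by omega] at hres
  have h1 : ((2 : MvPolynomial (ℕ ⊕ ℕ) ℤ) ^ (4 * (g + 1))) ^ 2 ∣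
      (resultant F (derivative F)) ^ 2 := by
    rw [sq (resultant F _), ← hmul, hdegF]
    refine Dvd.dvd.mul_right (dvd_of_eq ?_) _
    rw [← pow_mul, show (16 : MvPolynomial (ℕ ⊕ ℕ) ℤ) = 2 ^ 4 by norm_num, ← pow_mul]
    ring
  have h2 := (IsIntegrallyClosed.pow_dvd_pow_iff two_ne_zero).mp h1
  rw [hres, mul_assoc] at h2
  have h3 : (2 : MvPolynomial (ℕ ⊕ ℕ) ℤ) ^ (4 * (g + 1)) ∣ F.leadingCoeff * F.discr :=
    ((isUnit_one.neg.pow _).dvd_mul_left).mp h2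
  refine prime_two.pow_dvd_of_dvd_mul_left _ ?_ h3
  rw [leadingCoeff, hdegF]
  exact not_two_dvd_genericF_coeff g

/-- The discriminant of the generic equation `y² + Q(x) y = P(x)`: the polynomial `Δ` with
`2^{4(g+1)} Δ = disc (4P + Q²)`. -/
noncomputable def genericDisc (g : ℕ) : MvPolynomial (ℕ ⊕ ℕ) ℤ :=
  (two_pow_dvd_discr g).choose

theorem genericDisc_spec (g : ℕ) :
    (genericF g).discr = 2 ^ (4 * (g + 1)) * genericDisc g :=
  (two_pow_dvd_discr g).choose_spec

/-- The discriminant `Δ` of `y² + Q(x) y = P(x)`, where `deg Q ≤ g + 1` and `deg P ≤ 2g + 2`. -/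
noncomputable def disc {R : Type*} [CommRing R] (g : ℕ) (Q P : R[X]) : R :=
  MvPolynomial.aeval (Sum.elim Q.coeff P.coeff) (genericDisc g)

/-! ### Weierstrass equations

A smooth projective curve `C` over the field `K` is given by its function field `L`, and its closed
points are the valuation rings of `L`, other than `L`, that contain `K`. -/

/-- `w₀` is (the local ring of) a `K`-rational point of the curve over `K` with function
field `L`. -/
structure IsRationalPoint (K : Type*) {L : Type*} [Field K] [Field L] [Algebra K L]
    (w₀ : ValuationSubring L) : Prop where
  algebraMap_mem : ∀ a : K, algebraMap K L a ∈ w₀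
  ne_top : w₀ ≠ ⊤
  residue : ∀ f ∈ w₀, ∃ a : K, w₀.valuation (f - algebraMap K L a) < 1

/-- A Weierstrass equation `y² + Q(x) y = P(x)`, with coefficients in `R`, of the hyperelliptic
curve `C` of genus `g` over `K` with function field `L`: the functions `x`, `y` generate the
function field of `C`, they satisfy the equation, and the equation defines a smooth curve, in
other words its discriminant is nonzero. -/
structure WeierstrassEquation (R K L : Type*) [CommRing R] [Field K] [Field L] [Algebra R L]
    [Algebra K L] (g : ℕ) where
  Q : R[X]
  P : R[X]
  x : L
  y : L
  natDegree_Q_le : Q.natDegree ≤ g + 1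
  natDegree_P_le : P.natDegree ≤ 2 * g + 2
  disc_ne_zero : disc g Q P ≠ 0
  transcendental_x : Transcendental K x
  equation : y ^ 2 + aeval x Q * y = aeval x P
  adjoin_eq_top : IntermediateField.adjoin K {x, y} = ⊤

namespace WeierstrassEquation

variable {R K L : Type*} [CommRing R] [Field K] [Field L] [Algebra R L] [Algebra K L] {g : ℕ}

/-- The discriminant of a Weierstrass equation. -/
noncomputable def Δ (E : WeierstrassEquation R K L g) : R := disc g E.Q E.P

/-- The equation is a pointed Weierstrass equation of `(C, w₀)`: `deg Q ≤ g`, the polynomial `P` is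
monic of degree `2g + 1`, and `w₀` is the pole of `x`. -/
structure IsPointed (E : WeierstrassEquation R K L g) (w₀ : ValuationSubring L) : Prop where
  natDegree_Q_le : E.Q.natDegree ≤ g
  monic_P : E.P.Monic
  natDegree_P : E.P.natDegree = 2 * g + 1
  pole : E.x ∉ w₀

/-- The set `W₀(k)`, `k = R ⧸ 𝔭`, of rational points of the special fibre at `𝔭` of the affine chart
`W₀ = Spec R[x, y] / (y² + Q(x) y - P(x))` of the Weierstrass model `W`. -/
structure AffinePoint (E : WeierstrassEquation R K L g) (𝔭 : Ideal R) where
  x : R ⧸ 𝔭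
  y : R ⧸ 𝔭
  equation : y ^ 2 + (E.Q.map (Ideal.Quotient.mk 𝔭)).eval x * y =
    (E.P.map (Ideal.Quotient.mk 𝔭)).eval x

end WeierstrassEquation

/-! ### Multiplicities

Here `π` generates the prime `𝔭`, so that `emultiplicity π a` is the normalized `𝔭`-adic
valuation `v(a)` of `a`. -/

section Multiplicity

variable {R : Type*} [CommRing R]

/-- `μ_c(H) = min_i (v(a_i) + i)`, where `H(x) = ∑ a_i (x - c)^i`. -/
noncomputable def mu (π c : R) (H : R[X]) : ℕ∞ :=
  ⨅ i : ℕ, emultiplicity π ((taylor c H).coeff i) + i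

/-- `λ_c(Q, P) = min (2 μ_c(Q), μ_c(P))`. -/
noncomputable def lambdaPair (π c : R) (Q P : R[X]) : ℕ∞ :=
  min (2 * mu π c Q) (mu π c P)

end Multiplicity

namespace WeierstrassEquation

variable {R K L : Type*} [CommRing R] [Field K] [Field L] [Algebra R L] [Algebra K L] {g : ℕ}

/-- The multiplicity `λ(p₀) = max_H min (2 μ_c(Q - 2H), μ_c(P + QH - H²))`, where `H` runs through
all polynomials and `c` is a lift of `x(p₀)` (the value does not depend on the lift). -/
noncomputable def multiplicity (E : WeierstrassEquation R K L g) (π : R) {𝔭 : Ideal R}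
    (p₀ : E.AffinePoint 𝔭) : ℕ∞ :=
  ⨆ (c : R) (_ : Ideal.Quotient.mk 𝔭 c = p₀.x) (H : R[X]),
    lambdaPair π c (E.Q - 2 * H) (E.P + E.Q * H - H ^ 2)

/-- `E₁` is an equation of the dilatation `W(p₀)` of the Weierstrass model `W` defined by `E`.
One first replaces `y` by `y + H(x)`, so that the new pair
`(Q - 2H, P + QH - H²)` computes `λ(p₀)`; then `x = π x₁ + c` and `y + H(x) = π^r y₁`, where `c` is
a lift of `x(p₀)` and `r = ⌊λ(p₀)/2⌋`. The choices of `c` and `H` do not change the model. -/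
def IsDilatation (E : WeierstrassEquation R K L g) (π : R) {𝔭 : Ideal R} (p₀ : E.AffinePoint 𝔭)
    (E₁ : WeierstrassEquation R K L g) : Prop :=
  ∃ (c : R) (H : R[X]) (r : ℕ),
    Ideal.Quotient.mk 𝔭 c = p₀.x ∧ H.natDegree ≤ g + 1 ∧
    lambdaPair π c (E.Q - 2 * H) (E.P + E.Q * H - H ^ 2) = E.multiplicity π p₀ ∧
    2 * (r : ℕ∞) ≤ E.multiplicity π p₀ ∧ E.multiplicity π p₀ < 2 * (r : ℕ∞) + 2 ∧
    C (π ^ r) * E₁.Q = (E.Q - 2 * H).comp (C π * X + C c) ∧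
    C (π ^ (2 * r)) * E₁.P = (E.P + E.Q * H - H ^ 2).comp (C π * X + C c) ∧
    E.x = algebraMap R L π * E₁.x + algebraMap R L c ∧
    E.y + aeval E.x H = algebraMap R L (π ^ r) * E₁.y

/-- A pointed Weierstrass equation of `(C, w₀)` over `A` is pointed-minimal at `𝔭` if the
valuation of its discriminant is the smallest one among all pointed Weierstrass
equations of `(C, w₀)` over the local ring `A_𝔭` (here a subring of `K = Frac A`). -/
def IsPointedMinimalAt {A : Type*} [CommRing A] [IsDomain A] [Algebra A K] [IsFractionRing A K]
    [Algebra A L] (E : WeierstrassEquation A K L g) (w₀ : ValuationSubring L)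
    (𝔭 : Ideal A) [𝔭.IsPrime] (π : A) : Prop :=
  ∀ E' : WeierstrassEquation
      (Localization.subalgebra.ofField K 𝔭.primeCompl 𝔭.primeCompl_le_nonZeroDivisors) K L g,
    E'.IsPointed w₀ →
      emultiplicity π E.Δ ≤ emultiplicity
        (algebraMap A
          (Localization.subalgebra.ofField K 𝔭.primeCompl 𝔭.primeCompl_le_nonZeroDivisors) π) E'.Δ

end WeierstrassEquation

end Hyperelliptic

namespace Hyperelliptic

/-! ### Formulas for the discriminant -/

section Discriminant

variable {R S : Type*} [CommRing R] [CommRing S]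

/-! Smoothness makes K[x] + K[x]y integrally closed, so for a pointed equation it is the ring of
functions regular away from `w₀`, on which x and y have pole orders 2 and 2g+1
(`IsPointed.exists_of_isIntegralElem`, `IsPointed.valuation_sq`). Comparing pole orders, two pointed
equations differ by x = u²x' + b, y + H(x) = u^(2g+1) y' with deg H ≤ g (`IsPointed.exists_change`),
and then Δ = u^(4g(2g+1)) Δ'. A non-minimal equation therefore admits such a change with v(u) > 0 to
an equation over the local ring.

The arithmetic core is that b and H are then integral (`exists_integral_translation`). If b were
not, rescaling by ε = 1/b would degenerate the two right-hand sides to X^(2g+1) and (X-1)^(2g+1)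
over the residue field, and the relations between the equations would force both 2 = 0 and 2g+1 = 0
there. Once b and H are integral, u may be replaced by π and b, H by approximations over A: π^(2g+1)
divides (Q-2H)(π²X+c) and π^(4g+2) divides (P+QH-H²)(π²X+c) (`IsPointed.exists_C_dvd`).

The substitution by π² is two substitutions by π. Degree bounds give λ ≥ 2g+1 for the first, and the
leading coefficient of P excludes more; the second has λ ≥ 2g+2, and more would make a monic
polynomial of odd degree minus a square modulo π (`IsPointed.exists_points`). Conversely, the
dilatations at given `p₀` and `q₀` divide y by π^g and π^(g+1), so their composite is a change with
u = π; the second H can be adjusted so that the composite one has degree at most g. This gives a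
pointed equation whose discriminant has lost the factor π^(4g(2g+1)). -/

theorem map_disc (φ : R →+* S) (g : ℕ) (Q P : R[X]) :
    φ (disc g Q P) = disc g (Q.map φ) (P.map φ) := by
  have h := MvPolynomial.comp_aeval_apply (R := ℤ) (f := Sum.elim Q.coeff P.coeff)
    φ.toIntAlgHom (genericDisc g)
  refine h.trans ?_
  unfold disc
  congr 2
  funext i
  cases i <;> simp

/-- Specialization of the generic equation at a given one. -/
theorem map_genericF (g : ℕ) (Q P : R[X]) (hQ : Q.natDegree ≤ g + 1)
    (hP : P.natDegree ≤ 2 * g + 2) :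
    (genericF g).map (MvPolynomial.aeval (R := ℤ) (Sum.elim Q.coeff P.coeff)).toRingHom =
      4 * P + Q ^ 2 := by
  have h1 : (genericQ g).map (MvPolynomial.aeval (R := ℤ)
      (Sum.elim Q.coeff P.coeff)).toRingHom = Q := by
    ext i
    rw [coeff_map]
    by_cases hi : i < g + 2
    · rw [genericQ_coeff g i hi]; simp
    · rw [coeff_eq_zero_of_natDegree_lt (by have := genericQ_natDegree_le g; omega),
        coeff_eq_zero_of_natDegree_lt (by omega), map_zero]
  have h2 : (genericP g).map (MvPolynomial.aeval (R := ℤ)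
      (Sum.elim Q.coeff P.coeff)).toRingHom = P := by
    ext i
    rw [coeff_map]
    by_cases hi : i < 2 * g + 3
    · rw [genericP_coeff g i hi]; simp
    · rw [coeff_eq_zero_of_natDegree_lt (by have := genericP_natDegree_le g; omega),
        coeff_eq_zero_of_natDegree_lt (by omega), map_zero]
  rw [genericF, Polynomial.map_add, Polynomial.map_mul, Polynomial.map_pow, h1, h2,
    Polynomial.map_ofNat]

/-- Specializes the resultant formula of the generic equation, with formal degrees kept fixed. It
determines `disc` only where 2 and the leading coefficient can be cancelled, which is why the
identities below are first proved for lifts to a domain of characteristic zero. -/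
theorem resultant_derivative_eq_disc (g : ℕ) (Q P : R[X]) (hQ : Q.natDegree ≤ g + 1)
    (hP : P.natDegree ≤ 2 * g + 2) :
    resultant (4 * P + Q ^ 2) (derivative (4 * P + Q ^ 2)) (2 * g + 2) (2 * g + 1) =
      (-1) ^ ((2 * g + 2) * (2 * g + 1) / 2) * (4 * P + Q ^ 2).coeff (2 * g + 2) *
        (2 ^ (4 * (g + 1)) * disc g Q P) := by
  have hF := map_genericF g Q P hQ hP
  set ψ := (MvPolynomial.aeval (R := ℤ) (Sum.elim Q.coeff P.coeff)).toRingHom with hψ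
  have hres := resultant_deriv (f := genericF g)
    (natDegree_pos_iff_degree_pos.mp (by rw [genericF_natDegree]; omega))
  rw [genericDisc_spec, leadingCoeff, genericF_natDegree] at hres
  have := congrArg ψ hres
  rw [← resultant_map_map, ← derivative_map, hF] at this
  rw [show 2 * g + 1 = 2 * g + 2 - 1 by omega, this, ← hF, coeff_map]
  simp only [map_mul, map_pow, map_neg, map_one, map_ofNat]
  rfl

theorem natDegree_four_mul_add_sq_le {g : ℕ} {Q P : R[X]} (hQ : Q.natDegree ≤ g + 1)
    (hP : P.natDegree ≤ 2 * g + 2) : (4 * P + Q ^ 2).natDegree ≤ 2 * g + 2 := by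
  refine natDegree_add_le_of_degree_le ?_ ?_
  · refine natDegree_mul_le.trans ?_
    have : (4 : R[X]).natDegree = 0 := natDegree_ofNat 4
    omega
  · refine natDegree_pow_le.trans ?_
    omega

/-- A commutative ring is a quotient, by an ideal other than zero, of a domain of characteristic
zero. -/
theorem exists_surjective_of_charZero (R : Type*) [CommRing R] :
    ∃ φ : MvPolynomial (Option R) ℤ →+* R, Function.Surjective φ ∧
      ∃ t : MvPolynomial (Option R) ℤ, t ≠ 0 ∧ φ t = 0 := by
  refine ⟨(MvPolynomial.aeval (R := ℤ) (fun o : Option R => o.elim 0 id)).toRingHom,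
    fun r => ⟨MvPolynomial.X (some r), by simp⟩, MvPolynomial.X none, MvPolynomial.X_ne_zero _,
    by simp⟩

theorem exists_natDegree_le_lift {φ : S →+* R} (hφ : Function.Surjective φ) {n : ℕ} {p : R[X]}
    (hp : p.natDegree ≤ n) : ∃ q : S[X], q.map φ = p ∧ q.natDegree ≤ n := by
  obtain ⟨q, hq, hd⟩ := exists_degree_eq_of_mem_lifts (Polynomial.map_surjective φ hφ p)
  exact ⟨q, hq, (natDegree_eq_natDegree hd).le.trans hp⟩

/-- Adding t X^(2g+2), with t in the kernel, repairs a vanishing top coefficient of 4P + Q² without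
changing the specialization. -/
theorem exists_lift_coeff_ne_zero [IsDomain S] [CharZero S] {φ : S →+* R}
    (hφ : Function.Surjective φ) {t : S} (ht : t ≠ 0) (ht' : φ t = 0) (g : ℕ) {Q P : R[X]}
    (hQ : Q.natDegree ≤ g + 1) (hP : P.natDegree ≤ 2 * g + 2) :
    ∃ Q' P' : S[X], Q'.map φ = Q ∧ P'.map φ = P ∧ Q'.natDegree ≤ g + 1 ∧
      P'.natDegree ≤ 2 * g + 2 ∧ (4 * P' + Q' ^ 2).coeff (2 * g + 2) ≠ 0 := by
  obtain ⟨Q', h1, h2⟩ := exists_natDegree_le_lift hφ hQ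
  obtain ⟨P', h3, h4⟩ := exists_natDegree_le_lift hφ hP
  by_cases h : (4 * P' + Q' ^ 2).coeff (2 * g + 2) = 0
  · refine ⟨Q', P' + C t * X ^ (2 * g + 2), h1, by simp [h3, ht'], h2,
      natDegree_add_le_of_degree_le h4 (natDegree_C_mul_X_pow_le _ _), ?_⟩
    have : 4 * (P' + C t * X ^ (2 * g + 2)) + Q' ^ 2 =
        (4 * P' + Q' ^ 2) + C (4 * t) * X ^ (2 * g + 2) := by
      rw [C_mul, show (C 4 : S[X]) = 4 from map_ofNat C 4]; ring
    rw [this, coeff_add, h, coeff_C_mul_X_pow]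
    simpa using ht
  · exact ⟨Q', P', h1, h3, h2, h4, h⟩

theorem exists_lift_ne_zero {φ : S →+* R}
    (hφ : Function.Surjective φ) {t : S} (ht : t ≠ 0) (ht' : φ t = 0) (u : R) :
    ∃ u' : S, u' ≠ 0 ∧ φ u' = u := by
  obtain ⟨v, hv⟩ := hφ u
  by_cases h : v = 0
  · exact ⟨t, ht, by rw [ht', ← hv, h, map_zero]⟩
  · exact ⟨v, h, hv⟩

/-- The resultant is a power of the leading coefficient of f times the product of the values of h at
the roots of f. The substitution leaves these values unchanged, so only the leading coefficient
contributes powers of u. -/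
theorem resultant_comp_linear_of_isAlgClosed {K : Type*} [Field K] [IsAlgClosed K] {f h : K[X]}
    {n : ℕ} (hh : h.natDegree ≤ n) {u : K} (hu : u ≠ 0) (c : K) :
    resultant (f.comp (C u * X + C c)) (h.comp (C u * X + C c)) f.natDegree n =
      u ^ (f.natDegree * n) * resultant f h f.natDegree n := by
  have hlin : (C u * X + C c).natDegree = 1 := natDegree_linear hu
  have hd' : (f.comp (C u * X + C c)).natDegree = f.natDegree := by
    rw [natDegree_comp, hlin, mul_one]
  have hhd' : (h.comp (C u * X + C c)).natDegree ≤ n := by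
    rwa [natDegree_comp, hlin, mul_one]
  have e1 := resultant_eq_prod_eval (f.comp (C u * X + C c)) (h.comp (C u * X + C c)) n hhd'
    (IsAlgClosed.splits _)
  rw [hd'] at e1
  rw [e1, resultant_eq_prod_eval f h n hh (IsAlgClosed.splits _),
    ← map_roots_comp_C_mul_X_add_C f _ c hu.isUnit, leadingCoeff_comp (by omega),
    leadingCoeff_linear hu, Multiset.map_map]
  have : (h.eval ∘ fun x => u * x + c) = fun x => eval x (h.comp (C u * X + C c)) := by
    funext x; simp [eval_comp]
  simp only [this]
  ring

theorem map_comp_linear (φ : R →+* S) (f : R[X]) (u c : R) :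
    (f.comp (C u * X + C c)).map φ = (f.map φ).comp (C (φ u) * X + C (φ c)) := by
  simp [Polynomial.map_comp]

theorem resultant_comp_linear [IsDomain R] {f h : R[X]} {m n : ℕ} (hf : f.natDegree = m)
    (hh : h.natDegree ≤ n) {u : R} (hu : u ≠ 0) (c : R) :
    resultant (f.comp (C u * X + C c)) (h.comp (C u * X + C c)) m n =
      u ^ (m * n) * resultant f h m n := by
  obtain ⟨φ, hφ⟩ : ∃ φ : R →+* AlgebraicClosure (FractionRing R), Function.Injective φ :=
    ⟨(algebraMap (FractionRing R) _).comp (algebraMap R (FractionRing R)),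
      (algebraMap (FractionRing R) _).injective.comp (IsFractionRing.injective R _)⟩
  apply hφ
  have hd : (f.map φ).natDegree = m := by rw [natDegree_map_eq_of_injective hφ, hf]
  rw [map_mul, ← resultant_map_map, ← resultant_map_map, map_comp_linear, map_comp_linear,
    map_pow, ← hd]
  exact resultant_comp_linear_of_isAlgClosed (natDegree_map_le.trans hh)
    ((map_ne_zero_iff _ hφ).mpr hu) _

theorem comp_linear_eq_taylor (f : R[X]) (u c : R) :
    f.comp (C u * X + C c) = (taylor c f).comp (C u * X) := by
  simp [taylor_apply, comp_assoc]

theorem coeff_comp_linear {f : R[X]} {m : ℕ} (hf : f.natDegree ≤ m) (u c : R) :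
    (f.comp (C u * X + C c)).coeff m = u ^ m * f.coeff m := by
  rw [comp_linear_eq_taylor, comp_C_mul_X_coeff, mul_comm]
  congr 1
  rcases hf.lt_or_eq with h | rfl
  · rw [coeff_eq_zero_of_natDegree_lt h, coeff_eq_zero_of_natDegree_lt (by rwa [natDegree_taylor])]
  · rw [coeff_taylor_natDegree, leadingCoeff]

theorem natDegree_comp_linear_le (f : R[X]) (u c : R) :
    (f.comp (C u * X + C c)).natDegree ≤ f.natDegree := by
  refine natDegree_comp_le.trans ?_
  simpa using Nat.mul_le_mul_left f.natDegree (natDegree_linear_le (a := u) (b := c))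

theorem derivative_comp_linear (f : R[X]) (u c : R) :
    derivative (f.comp (C u * X + C c)) = C u * (derivative f).comp (C u * X + C c) := by
  rw [derivative_comp]; simp

/-- The discriminant after the change of variable `x = u x' + c`. -/
theorem disc_comp_linear (g : ℕ) {Q P : R[X]} (hQ : Q.natDegree ≤ g + 1)
    (hP : P.natDegree ≤ 2 * g + 2) (u c : R) :
    disc g (Q.comp (C u * X + C c)) (P.comp (C u * X + C c)) =
      u ^ ((2 * g + 2) * (2 * g + 1)) * disc g Q P := by
  obtain ⟨φ, hφ, t, ht, ht'⟩ := exists_surjective_of_charZero R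
  obtain ⟨Q, P, rfl, rfl, hQ', hP', hF⟩ := exists_lift_coeff_ne_zero hφ ht ht' g hQ hP
  obtain ⟨u, hu, rfl⟩ := exists_lift_ne_zero hφ ht ht' u
  obtain ⟨c, rfl⟩ := hφ c
  have key : disc g (Q.comp (C u * X + C c)) (P.comp (C u * X + C c)) =
      u ^ ((2 * g + 2) * (2 * g + 1)) * disc g Q P := by
    have e1 := resultant_derivative_eq_disc g Q P hQ' hP'
    have e2 := resultant_derivative_eq_disc g _ _
      ((natDegree_comp_linear_le Q u c).trans hQ') ((natDegree_comp_linear_le P u c).trans hP')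
    have hc : 4 * P.comp (C u * X + C c) + Q.comp (C u * X + C c) ^ 2 =
        (4 * P + Q ^ 2).comp (C u * X + C c) := by
      simp [add_comp, mul_comp]
    have hdF := natDegree_four_mul_add_sq_le hQ' hP'
    rw [hc, derivative_comp_linear, resultant_C_mul_right, coeff_comp_linear hdF,
      resultant_comp_linear (le_antisymm hdF (le_natDegree_of_ne_zero hF))
        ((natDegree_derivative_le _).trans (by omega)) hu, e1] at e2
    have hne : (-1) ^ ((2 * g + 2) * (2 * g + 1) / 2) * (4 * P + Q ^ 2).coeff (2 * g + 2) *
        2 ^ (4 * (g + 1)) * u ^ (2 * g + 2) ≠ 0 := by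
      refine mul_ne_zero (mul_ne_zero (mul_ne_zero ?_ hF) ?_) (pow_ne_zero _ hu)
      · exact pow_ne_zero _ (neg_ne_zero.mpr one_ne_zero)
      · exact pow_ne_zero _ two_ne_zero
    refine mul_left_cancel₀ hne ?_
    linear_combination -e2
  have := congrArg φ key
  rw [map_mul, map_disc, map_disc, Polynomial.map_comp, Polynomial.map_comp] at this
  simpa using this

/-- The discriminant after the change of variable `y' = s y`. -/
theorem disc_C_mul (g : ℕ) {Q P : R[X]} (hQ : Q.natDegree ≤ g + 1)
    (hP : P.natDegree ≤ 2 * g + 2) (s : R) :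
    disc g (C s * Q) (C (s ^ 2) * P) = s ^ (4 * (2 * g + 1)) * disc g Q P := by
  obtain ⟨φ, hφ, t, ht, ht'⟩ := exists_surjective_of_charZero R
  obtain ⟨Q, P, rfl, rfl, hQ', hP', hF⟩ := exists_lift_coeff_ne_zero hφ ht ht' g hQ hP
  obtain ⟨s, hs, rfl⟩ := exists_lift_ne_zero hφ ht ht' s
  have key : disc g (C s * Q) (C (s ^ 2) * P) = s ^ (4 * (2 * g + 1)) * disc g Q P := by
    have e1 := resultant_derivative_eq_disc g Q P hQ' hP'
    have e2 := resultant_derivative_eq_disc g (C s * Q) (C (s ^ 2) * P)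
      ((natDegree_C_mul_le _ _).trans hQ') ((natDegree_C_mul_le _ _).trans hP')
    have hc : 4 * (C (s ^ 2) * P) + (C s * Q) ^ 2 = C (s ^ 2) * (4 * P + Q ^ 2) := by
      rw [C_pow]; ring
    rw [hc, derivative_C_mul, resultant_C_mul_right, resultant_C_mul_left, coeff_C_mul, e1] at e2
    have hne : (-1) ^ ((2 * g + 2) * (2 * g + 1) / 2) * (4 * P + Q ^ 2).coeff (2 * g + 2) *
        2 ^ (4 * (g + 1)) * s ^ 2 ≠ 0 := by
      refine mul_ne_zero (mul_ne_zero (mul_ne_zero ?_ hF) ?_) (pow_ne_zero _ hs)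
      · exact pow_ne_zero _ (neg_ne_zero.mpr one_ne_zero)
      · exact pow_ne_zero _ two_ne_zero
    refine mul_left_cancel₀ hne ?_
    have hp : (s ^ 2) ^ (2 * g + 2) * (s ^ 2) ^ (2 * g + 1) = s ^ 2 * s ^ (4 * (2 * g + 1)) := by
      ring
    linear_combination -e2 + (-1) ^ ((2 * g + 2) * (2 * g + 1) / 2) *
      (4 * P + Q ^ 2).coeff (2 * g + 2) * (2 ^ (4 * (g + 1)) * disc g Q P) * hp
  have := congrArg φ key
  rw [map_mul, map_disc, map_disc] at this
  simpa using this

theorem natDegree_sub_two_mul_le {n : ℕ} {Q H : R[X]} (hQ : Q.natDegree ≤ n)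
    (hH : H.natDegree ≤ n) : (Q - 2 * H).natDegree ≤ n := by
  refine (natDegree_sub_le_of_le hQ ?_).trans (max_self n).le
  refine natDegree_mul_le.trans ?_
  have : (2 : R[X]).natDegree = 0 := natDegree_ofNat 2
  omega

theorem natDegree_add_mul_sub_sq_le {n : ℕ} {Q P H : R[X]} (hQ : Q.natDegree ≤ n)
    (hP : P.natDegree ≤ 2 * n) (hH : H.natDegree ≤ n) :
    (P + Q * H - H ^ 2).natDegree ≤ 2 * n := by
  refine (natDegree_sub_le_of_le (natDegree_add_le_of_degree_le hP ?_) ?_).trans (max_self _).le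
  · refine natDegree_mul_le.trans ?_
    omega
  · refine natDegree_pow_le.trans ?_
    omega

/-- The discriminant after the change of variable `y' = y + H(x)`. -/
theorem disc_sub_two_mul (g : ℕ) {Q P H : R[X]} (hQ : Q.natDegree ≤ g + 1)
    (hP : P.natDegree ≤ 2 * g + 2) (hH : H.natDegree ≤ g + 1) :
    disc g (Q - 2 * H) (P + Q * H - H ^ 2) = disc g Q P := by
  obtain ⟨φ, hφ, t, ht, ht'⟩ := exists_surjective_of_charZero R
  obtain ⟨Q, P, rfl, rfl, hQ', hP', hF⟩ := exists_lift_coeff_ne_zero hφ ht ht' g hQ hP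
  obtain ⟨H, rfl, hH'⟩ := exists_natDegree_le_lift hφ hH
  have key : disc g (Q - 2 * H) (P + Q * H - H ^ 2) = disc g Q P := by
    have e1 := resultant_derivative_eq_disc g Q P hQ' hP'
    have e2 := resultant_derivative_eq_disc g (Q - 2 * H) (P + Q * H - H ^ 2)
      (natDegree_sub_two_mul_le hQ' hH')
      (natDegree_add_mul_sub_sq_le (n := g + 1) hQ' hP' hH')
    have hc : 4 * (P + Q * H - H ^ 2) + (Q - 2 * H) ^ 2 = 4 * P + Q ^ 2 := by
      ring
    rw [hc, e1] at e2
    have hne : (-1) ^ ((2 * g + 2) * (2 * g + 1) / 2) * (4 * P + Q ^ 2).coeff (2 * g + 2) *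
        2 ^ (4 * (g + 1)) ≠ 0 := by
      refine mul_ne_zero (mul_ne_zero ?_ hF) ?_
      · exact pow_ne_zero _ (neg_ne_zero.mpr one_ne_zero)
      · exact pow_ne_zero _ two_ne_zero
    refine mul_left_cancel₀ hne ?_
    linear_combination -e2
  have := congrArg φ key
  rw [map_disc, map_disc] at this
  simpa using this

/-- Here 4P + Q² becomes X² times a polynomial, so it and its derivative both vanish at 0; hence so
does their resultant, a combination of the two. -/
theorem disc_X_mul_eq_zero (g : ℕ) {Q P : R[X]} (hQ : Q.natDegree ≤ g)
    (hP : P.natDegree ≤ 2 * g) : disc g (X * Q) (X ^ 2 * P) = 0 := by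
  obtain ⟨φ, hφ, t, ht, ht'⟩ := exists_surjective_of_charZero R
  obtain ⟨Q, rfl, hQ'⟩ := exists_natDegree_le_lift hφ hQ
  obtain ⟨P, rfl, hP'⟩ := exists_natDegree_le_lift hφ hP
  have key : ∀ P : (MvPolynomial (Option R) ℤ)[X], P.natDegree ≤ 2 * g →
      (4 * P + Q ^ 2).coeff (2 * g) ≠ 0 → disc g (X * Q) (X ^ 2 * P) = 0 := by
    intro P hP' hF
    have hXQ : (X * Q).natDegree ≤ g + 1 := by
      refine natDegree_mul_le.trans ?_
      have := natDegree_X_le (R := MvPolynomial (Option R) ℤ)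
      omega
    have hXP : (X ^ 2 * P).natDegree ≤ 2 * g + 2 := by
      refine natDegree_mul_le.trans ?_
      have := natDegree_X_pow_le (R := MvPolynomial (Option R) ℤ) 2
      omega
    have e := resultant_derivative_eq_disc g (X * Q) (X ^ 2 * P) hXQ hXP
    have hc : 4 * (X ^ 2 * P) + (X * Q) ^ 2 = X * (X * (4 * P + Q ^ 2)) := by ring
    have hcoeff : (X * (X * (4 * P + Q ^ 2))).coeff (2 * g + 2) ≠ 0 := by
      rwa [coeff_X_mul, coeff_X_mul]
    have hdeg : (X * (X * (4 * P + Q ^ 2))).natDegree = 2 * g + 2 := by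
      refine le_antisymm ?_ (le_natDegree_of_ne_zero hcoeff)
      rw [← hc]
      exact natDegree_four_mul_add_sq_le hXQ hXP
    rw [hc] at e
    have h0 : resultant (X * (X * (4 * P + Q ^ 2))) (derivative (X * (X * (4 * P + Q ^ 2))))
        (2 * g + 2) (2 * g + 1) = 0 := by
      obtain ⟨p, q, -, -, hpq⟩ := exists_mul_add_mul_eq_C_resultant (m := 2 * g + 2)
        (n := 2 * g + 1) (X * (X * (4 * P + Q ^ 2))) (derivative (X * (X * (4 * P + Q ^ 2))))
        hdeg.le ((natDegree_derivative_le _).trans (by omega)) (Or.inl (by omega))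
      have := congrArg (eval 0) hpq
      simpa using this.symm
    rw [h0] at e
    have hne : (-1) ^ ((2 * g + 2) * (2 * g + 1) / 2) *
        (X * (X * (4 * P + Q ^ 2))).coeff (2 * g + 2) * 2 ^ (4 * (g + 1)) ≠ 0 := by
      refine mul_ne_zero (mul_ne_zero ?_ hcoeff) ?_
      · exact pow_ne_zero _ (neg_ne_zero.mpr one_ne_zero)
      · exact pow_ne_zero _ two_ne_zero
    refine mul_left_cancel₀ hne ?_
    linear_combination -e
  -- The lift has to keep the factors X and X², so only the cofactor P is perturbed.
  have key' : ∃ P' : (MvPolynomial (Option R) ℤ)[X], P'.map φ = P.map φ ∧ P'.natDegree ≤ 2 * g ∧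
      (4 * P' + Q ^ 2).coeff (2 * g) ≠ 0 := by
    by_cases h : (4 * P + Q ^ 2).coeff (2 * g) = 0
    · refine ⟨P + C t * X ^ (2 * g), by simp [ht'],
        natDegree_add_le_of_degree_le hP' (natDegree_C_mul_X_pow_le _ _), ?_⟩
      have : 4 * (P + C t * X ^ (2 * g)) + Q ^ 2 =
          (4 * P + Q ^ 2) + C (4 * t) * X ^ (2 * g) := by
        rw [C_mul, show (C 4 : (MvPolynomial (Option R) ℤ)[X]) = 4 from map_ofNat C 4]; ring
      rw [this, coeff_add, h, coeff_C_mul_X_pow]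
      simpa using ht
    · exact ⟨P, rfl, hP', h⟩
  obtain ⟨P', h1, h2, h3⟩ := key'
  have := congrArg φ (key P' h2 h3)
  rw [map_disc] at this
  simpa [h1] using this

theorem disc_eq_zero_of_X_dvd (g : ℕ) {Q P : R[X]} (hQ : Q.natDegree ≤ g + 1)
    (hP : P.natDegree ≤ 2 * g + 2) (hQ0 : X ∣ Q) (hP0 : X ^ 2 ∣ P) : disc g Q P = 0 := by
  nontriviality R
  obtain ⟨Q, rfl⟩ := hQ0
  obtain ⟨P, rfl⟩ := hP0
  refine disc_X_mul_eq_zero g ?_ ?_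
  · by_cases h : Q = 0
    · simp [h]
    · rw [natDegree_X_mul h] at hQ; omega
  · by_cases h : P = 0
    · simp [h]
    · rw [natDegree_X_pow_mul _ h] at hP; omega

/-- The discriminant of an equation that defines a singular curve is zero. -/
theorem disc_eq_zero_of_singular (g : ℕ) {Q P : R[X]} (hQ : Q.natDegree ≤ g + 1)
    (hP : P.natDegree ≤ 2 * g + 2) {a b : R} (h0 : b ^ 2 + Q.eval a * b = P.eval a)
    (hy : 2 * b + Q.eval a = 0) (hx : (derivative Q).eval a * b = (derivative P).eval a) :
    disc g Q P = 0 := by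
  -- Moving the singular point (a, b) to the origin makes X divide Q and X² divide P.
  have hH : (C (-b) : R[X]).natDegree ≤ g + 1 := by simp
  have h1 := disc_sub_two_mul g hQ hP hH
  have h2 := disc_comp_linear g (natDegree_sub_two_mul_le hQ hH)
    (natDegree_add_mul_sub_sq_le (n := g + 1) hQ hP hH) 1 a
  rw [one_pow, one_mul, h1] at h2
  rw [← h2]
  refine disc_eq_zero_of_X_dvd g
    ((natDegree_comp_linear_le _ _ _).trans (natDegree_sub_two_mul_le hQ hH))
    ((natDegree_comp_linear_le _ _ _).trans
      (natDegree_add_mul_sub_sq_le (n := g + 1) hQ hP hH)) ?_ ?_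
  · rw [X_dvd_iff, coeff_zero_eq_eval_zero]
    simp [eval_comp]
    linear_combination hy
  · rw [X_pow_dvd_iff]
    intro d hd
    interval_cases d
    · rw [coeff_zero_eq_eval_zero]
      simp [eval_comp]
      linear_combination -h0
    · rw [C_1, one_mul, ← taylor_apply, taylor_coeff_one]
      simp [derivative_pow]
      linear_combination -hx

end Discriminant

/-! ### The affine curve is normal -/

section Normal

variable {K : Type*} [Field K]

/-- If β(c) ≠ 0, then (c, -α(c)/β(c)) is a singular point: the trace condition kills the
y-derivative, and the double zero of the norm kills the x-derivative. -/
theorem X_sub_C_dvd_of_sq_dvd_norm {g : ℕ} {Q P : K[X]} (hQ : Q.natDegree ≤ g + 1)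
    (hP : P.natDegree ≤ 2 * g + 2) (hD : disc g Q P ≠ 0) {α β : K[X]} {c : K}
    (h1 : X - C c ∣ 2 * α - β * Q)
    (h2 : (X - C c) ^ 2 ∣ α ^ 2 - α * β * Q - β ^ 2 * P) : X - C c ∣ α ∧ X - C c ∣ β := by
  have e1 : 2 * α.eval c - β.eval c * Q.eval c = 0 := by
    have := dvd_iff_isRoot.mp h1
    simpa [IsRoot] using this
  obtain ⟨k, hk⟩ := h2
  have e2 : α.eval c ^ 2 - α.eval c * β.eval c * Q.eval c - β.eval c ^ 2 * P.eval c = 0 := by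
    simpa using congrArg (eval c) hk
  have e3 := congrArg (fun p => eval c (derivative p)) hk
  simp [derivative_pow] at e3
  have hβ : β.eval c = 0 := by
    by_contra hβ
    refine hD (disc_eq_zero_of_singular g hQ hP (a := c) (b := -(α.eval c / β.eval c)) ?_ ?_ ?_)
    · field_simp
      linear_combination e2
    · field_simp
      linear_combination -e1
    · field_simp
      refine mul_left_cancel₀ hβ ?_
      have e2' : β.eval c * (-(α.eval c * Q.eval c) - 2 * β.eval c * P.eval c) = 0 := by
        linear_combination 2 * e2 - α.eval c * e1
      have e2'' := (mul_eq_zero.mp e2').resolve_left hβ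
      linear_combination e3 - (derivative α).eval c * e1 - (derivative β).eval c * e2''
  have hα : α.eval c = 0 := by
    rw [hβ] at e2
    simpa using e2
  exact ⟨dvd_iff_isRoot.mpr hα, dvd_iff_isRoot.mpr hβ⟩

/-- Roots of m are split off one at a time. The trace is homogeneous of degree 1 and the norm of
degree 2 in (α, β), so both hypotheses survive the cancellation. -/
theorem dvd_of_sq_dvd_norm_of_isAlgClosed [IsAlgClosed K] {g : ℕ} {Q P : K[X]}
    (hQ : Q.natDegree ≤ g + 1) (hP : P.natDegree ≤ 2 * g + 2) (hD : disc g Q P ≠ 0) (n : ℕ) :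
    ∀ {α β m : K[X]}, m.natDegree = n → m ≠ 0 → m ∣ 2 * α - β * Q →
      m ^ 2 ∣ α ^ 2 - α * β * Q - β ^ 2 * P → m ∣ α ∧ m ∣ β := by
  induction n with
  | zero =>
    intro α β m hm hm0 _ _
    have hu : IsUnit m := isUnit_iff_degree_eq_zero.mpr
      ((degree_eq_natDegree hm0).trans (by rw [hm]; rfl))
    exact ⟨hu.dvd, hu.dvd⟩
  | succ n ih =>
    intro α β m hm hm0 h1 h2
    obtain ⟨c, hc⟩ := IsAlgClosed.exists_root m (by
      rw [degree_eq_natDegree hm0, hm]; exact_mod_cast Nat.succ_ne_zero n)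
    obtain ⟨m, rfl⟩ := dvd_iff_isRoot.mpr hc
    have hm0' : m ≠ 0 := right_ne_zero_of_mul hm0
    have hX : X - C c ≠ 0 := X_sub_C_ne_zero c
    obtain ⟨⟨α, rfl⟩, ⟨β, rfl⟩⟩ := X_sub_C_dvd_of_sq_dvd_norm hQ hP hD
      ((dvd_mul_right _ _).trans h1)
      ((pow_dvd_pow_of_dvd (dvd_mul_right _ _) 2).trans h2)
    rw [natDegree_mul hX hm0', natDegree_X_sub_C] at hm
    have := @ih α β m (by omega) hm0'
      ((mul_dvd_mul_iff_left hX).mp (by convert h1 using 1; ring))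
      ((mul_dvd_mul_iff_left (pow_ne_zero 2 hX)).mp (by
        rw [← mul_pow]; convert h2 using 1; ring))
    exact ⟨mul_dvd_mul_left _ this.1, mul_dvd_mul_left _ this.2⟩

/-- If trace and norm of `(α + β y) / m` are polynomials, then so are `α / m` and `β / m`. -/
theorem dvd_of_sq_dvd_norm {g : ℕ} {Q P : K[X]}
    (hQ : Q.natDegree ≤ g + 1) (hP : P.natDegree ≤ 2 * g + 2) (hD : disc g Q P ≠ 0)
    {α β m : K[X]} (hm : m ≠ 0) (h1 : m ∣ 2 * α - β * Q)
    (h2 : m ^ 2 ∣ α ^ 2 - α * β * Q - β ^ 2 * P) : m ∣ α ∧ m ∣ β := by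
  let φ := algebraMap K (AlgebraicClosure K)
  have := dvd_of_sq_dvd_norm_of_isAlgClosed (g := g) (Q := Q.map φ) (P := P.map φ)
    (natDegree_map_le.trans hQ) (natDegree_map_le.trans hP)
    (by rw [← map_disc]; exact (map_ne_zero φ).mpr hD) _ (α := α.map φ) (β := β.map φ)
    (m := m.map φ) rfl ((Polynomial.map_ne_zero_iff φ.injective).mpr hm)
    (by simpa using Polynomial.map_dvd φ h1) (by simpa using Polynomial.map_dvd φ h2)
  rwa [map_dvd_map', map_dvd_map'] at this

end Normal

/-! ### The function field -/

namespace WeierstrassEquation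

section FunctionField

variable {K L : Type*} [Field K] [Field L] [Algebra K L] {g : ℕ}
  (E : WeierstrassEquation K K L g) {w₀ : ValuationSubring L}

theorem conj_eq (α β : K[X]) :
    (aeval E.x α + aeval E.x β * E.y) *
        (aeval E.x α + aeval E.x β * (-aeval E.x E.Q - E.y)) =
      aeval E.x (α ^ 2 - α * β * E.Q - β ^ 2 * E.P) := by
  simp only [map_sub, map_mul, map_pow]
  linear_combination -aeval E.x β ^ 2 * E.equation

theorem aeval_x_injective : Function.Injective (aeval E.x : K[X] →ₐ[K] L) :=
  transcendental_iff_injective.mp E.transcendental_x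

theorem aeval_x_eq_zero {p : K[X]} : aeval E.x p = 0 ↔ p = 0 :=
  map_eq_zero_iff _ E.aeval_x_injective

variable {E}

/-- Parity: β²P has odd degree 2 deg β + 2g + 1, whereas α² - αβQ either has even degree 2 deg α or
has degree at most 2 deg β + 2g. -/
theorem IsPointed.norm_eq_zero (hE : E.IsPointed w₀) {α β : K[X]}
    (h : α ^ 2 - α * β * E.Q - β ^ 2 * E.P = 0) : α = 0 ∧ β = 0 := by
  have hβ : β = 0 := by
    by_contra hβ
    have hr : (β ^ 2 * E.P).natDegree = 2 * β.natDegree + (2 * g + 1) := by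
      rw [natDegree_mul (pow_ne_zero 2 hβ) hE.monic_P.ne_zero, natDegree_pow, hE.natDegree_P]
    rw [← sub_eq_zero.mp h] at hr
    have h1 : (α ^ 2).natDegree = 2 * α.natDegree := natDegree_pow _ _
    have h2 : (α * β * E.Q).natDegree ≤ α.natDegree + β.natDegree + g :=
      natDegree_mul_le.trans (add_le_add natDegree_mul_le hE.natDegree_Q_le)
    rcases le_or_gt α.natDegree (β.natDegree + g) with h3 | h3
    · have := natDegree_sub_le (α ^ 2) (α * β * E.Q)
      omega
    · rw [natDegree_sub_eq_left_of_natDegree_lt (by omega)] at hr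
      omega
  rw [hβ] at h
  exact ⟨by simpa using h, hβ⟩

theorem IsPointed.linearIndependent (hE : E.IsPointed w₀) {α β : K[X]}
    (h : aeval E.x α + aeval E.x β * E.y = 0) : α = 0 ∧ β = 0 := by
  have := E.conj_eq α β
  rw [h, zero_mul, eq_comm, aeval_x_eq_zero] at this
  exact hE.norm_eq_zero this

theorem IsPointed.linearIndependent' (hE : E.IsPointed w₀) {α β α' β' : K[X]}
    (h : aeval E.x α + aeval E.x β * E.y = aeval E.x α' + aeval E.x β' * E.y) :
    α = α' ∧ β = β' := by
  have := hE.linearIndependent (α := α - α') (β := β - β') (by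
    rw [map_sub, map_sub]; linear_combination h)
  exact ⟨sub_eq_zero.mp this.1, sub_eq_zero.mp this.2⟩

/-- Such quotients are closed under the field operations; for inverses, multiply by the conjugate,
whose product with α + βy is the nonzero norm. -/
theorem IsPointed.exists_eq_div (hE : E.IsPointed w₀) (f : L) :
    ∃ α β m : K[X], m ≠ 0 ∧ aeval E.x m * f = aeval E.x α + aeval E.x β * E.y := by
  have hf : f ∈ IntermediateField.adjoin K {E.x, E.y} := by
    rw [E.adjoin_eq_top]; trivial
  induction hf using IntermediateField.adjoin_induction with
  | mem f hf =>
    rcases hf with rfl | rfl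
    · exact ⟨X, 0, 1, one_ne_zero, by simp⟩
    · exact ⟨0, 1, 1, one_ne_zero, by simp⟩
  | algebraMap a => exact ⟨C a, 0, 1, one_ne_zero, by simp⟩
  | add f f' _ _ h h' =>
    obtain ⟨α, β, m, hm, e⟩ := h
    obtain ⟨α', β', m', hm', e'⟩ := h'
    refine ⟨m' * α + m * α', m' * β + m * β', m * m', mul_ne_zero hm hm', ?_⟩
    simp only [map_add, map_mul]
    linear_combination aeval E.x m' * e + aeval E.x m * e'
  | mul f f' _ _ h h' =>
    obtain ⟨α, β, m, hm, e⟩ := h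
    obtain ⟨α', β', m', hm', e'⟩ := h'
    refine ⟨α * α' + β * β' * E.P, α * β' + α' * β - β * β' * E.Q, m * m',
      mul_ne_zero hm hm', ?_⟩
    simp only [map_add, map_mul, map_sub]
    linear_combination aeval E.x m' * f' * e + (aeval E.x α + aeval E.x β * E.y) * e' +
      aeval E.x β * aeval E.x β' * E.equation
  | inv f _ h =>
    obtain ⟨α, β, m, hm, e⟩ := h
    by_cases hf : f = 0
    · exact ⟨0, 0, 1, one_ne_zero, by simp [hf]⟩
    · refine ⟨m * (α - β * E.Q), -m * β, α ^ 2 - α * β * E.Q - β ^ 2 * E.P, fun h0 => ?_, ?_⟩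
      · obtain ⟨rfl, rfl⟩ := hE.norm_eq_zero h0
        have : aeval E.x m ≠ 0 := fun h => hm (E.aeval_x_eq_zero.mp h)
        simp [this, hf] at e
      · rw [← conj_eq, ← e]
        field_simp
        simp only [map_mul, map_sub, map_neg]
        ring

/-! ### Valuations at the pole of x -/

theorem valuation_algebraMap_eq_one {V : ValuationSubring L} (hV : ∀ a : K, algebraMap K L a ∈ V)
    {a : K} (ha : a ≠ 0) : V.valuation (algebraMap K L a) = 1 := by
  refine le_antisymm ((V.valuation_le_one_iff _).mpr (hV a)) ?_
  have h := (V.valuation_le_one_iff _).mpr (hV a⁻¹)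
  rw [map_inv₀, map_inv₀] at h
  exact (inv_le_one₀ (by simpa [zero_lt_iff] using ha)).mp h

theorem valuation_aeval_le {V : ValuationSubring L} (hV : ∀ a : K, algebraMap K L a ∈ V) {x : L}
    (hx : 1 ≤ V.valuation x) {p : K[X]} {n : ℕ} (hp : p.natDegree ≤ n) :
    V.valuation (aeval x p) ≤ V.valuation x ^ n := by
  rw [aeval_eq_sum_range]
  refine Valuation.map_sum_le _ fun i hi => ?_
  rw [Algebra.smul_def, map_mul, map_pow]
  refine (mul_le_of_le_one_left' ((V.valuation_le_one_iff _).mpr (hV _))).trans ?_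
  have := Finset.mem_range.mp hi
  exact pow_le_pow_right₀ hx (by omega)

theorem valuation_aeval {V : ValuationSubring L} (hV : ∀ a : K, algebraMap K L a ∈ V) {x : L}
    (hx : 1 < V.valuation x) {p : K[X]} (hp : p ≠ 0) :
    V.valuation (aeval x p) = V.valuation x ^ p.natDegree := by
  have hlead : V.valuation (algebraMap K L p.leadingCoeff * x ^ p.natDegree) =
      V.valuation x ^ p.natDegree := by
    rw [map_mul, valuation_algebraMap_eq_one hV (leadingCoeff_ne_zero.mpr hp), one_mul, map_pow]
  have hsplit : aeval x p = algebraMap K L p.leadingCoeff * x ^ p.natDegree +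
      aeval x p.eraseLead := by
    have h := congrArg (aeval x) (eraseLead_add_C_mul_X_pow p)
    rw [map_add, map_mul, aeval_C, map_pow, aeval_X, add_comm] at h
    exact h.symm
  rw [hsplit]
  by_cases h0 : p.natDegree = 0
  · have : p.eraseLead = 0 := by
      rw [eq_C_of_natDegree_eq_zero h0]; simp
    rw [this, map_zero, add_zero, hlead]
  · rw [Valuation.map_add_eq_of_lt_left, hlead]
    rw [hlead]
    refine (valuation_aeval_le hV hx.le (n := p.natDegree - 1)
      (eraseLead_natDegree_le p)).trans_lt ?_
    exact pow_lt_pow_right₀ hx (by omega)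

theorem one_lt_valuation {V : ValuationSubring L} {x : L} (hx : x ∉ V) : 1 < V.valuation x := by
  rwa [← not_le, V.valuation_le_one_iff]

/-- If y were at most x^g in size, then y² + Qy would be at most x^(2g), too small for P(x). So y²
dominates Qy and alone has the size of P(x). -/
theorem IsPointed.valuation_y {V : ValuationSubring L} (hE : E.IsPointed V)
    (hV : ∀ a : K, algebraMap K L a ∈ V) :
    V.valuation E.y ^ 2 = V.valuation E.x ^ (2 * g + 1) := by
  have hx := one_lt_valuation hE.pole
  have hP := valuation_aeval hV hx hE.monic_P.ne_zero
  rw [hE.natDegree_P] at hP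
  have hQ := valuation_aeval_le hV hx.le hE.natDegree_Q_le
  rw [← hP, ← map_pow]
  have heq : aeval E.x E.P = E.y ^ 2 + aeval E.x E.Q * E.y := E.equation.symm
  rcases le_or_gt (V.valuation E.y) (V.valuation E.x ^ g) with h | h
  · exfalso
    have h1 : V.valuation (aeval E.x E.P) ≤ V.valuation E.x ^ (2 * g) := by
      rw [heq]
      refine Valuation.map_add_le _ ?_ ?_
      · rw [map_pow, mul_comm, pow_mul]
        exact pow_le_pow_left₀ zero_le h 2
      · rw [map_mul, two_mul, pow_add]
        exact mul_le_mul' hQ h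
    rw [hP] at h1
    exact absurd h1 (not_le.mpr (pow_lt_pow_right₀ hx (by omega)))
  · rw [heq, Valuation.map_add_eq_of_lt_left]
    rw [map_mul, map_pow, sq]
    exact mul_lt_mul_of_pos_right (hQ.trans_lt h) (zero_le.trans_lt h)

/-- The order of the pole of `α(x) + β(x) y` at infinity. -/
noncomputable def poleOrder (g : ℕ) (α β : K[X]) : ℕ :=
  open Classical in
  if β = 0 then 2 * α.natDegree else max (2 * α.natDegree) (2 * β.natDegree + (2 * g + 1))

/-- The two summands have pole orders of different parity, so they cannot cancel. Squaring avoids a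
half-integral exponent of the valuation of x. -/
theorem IsPointed.valuation_sq {V : ValuationSubring L} (hE : E.IsPointed V)
    (hV : ∀ a : K, algebraMap K L a ∈ V) {α β : K[X]} (h : α ≠ 0 ∨ β ≠ 0) :
    V.valuation (aeval E.x α + aeval E.x β * E.y) ^ 2 = V.valuation E.x ^ poleOrder g α β := by
  have hx := one_lt_valuation hE.pole
  unfold poleOrder
  have hα : α ≠ 0 → V.valuation (aeval E.x α) ^ 2 = V.valuation E.x ^ (2 * α.natDegree) := by
    intro h
    rw [valuation_aeval hV hx h, ← pow_mul, mul_comm]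
  have hβ' : β ≠ 0 → V.valuation (aeval E.x β * E.y) ^ 2 =
      V.valuation E.x ^ (2 * β.natDegree + (2 * g + 1)) := by
    intro h
    rw [map_mul, mul_pow, hE.valuation_y hV, valuation_aeval hV hx h, ← pow_mul, ← pow_add,
      mul_comm β.natDegree]
  split_ifs with hβ
  · subst hβ
    simpa using hα (by simpa using h)
  · by_cases hα0 : α = 0
    · subst hα0
      simpa using hβ' hβ
    · rcases lt_or_ge (2 * α.natDegree) (2 * β.natDegree + (2 * g + 1)) with hlt | hlt
      · rw [max_eq_right hlt.le, Valuation.map_add_eq_of_lt_right, hβ' hβ]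
        refine lt_of_pow_lt_pow_left₀ 2 zero_le ?_
        rw [hα hα0, hβ' hβ]
        exact pow_lt_pow_right₀ hx hlt
      · rw [max_eq_left hlt, Valuation.map_add_eq_of_lt_left, hα hα0]
        refine lt_of_pow_lt_pow_left₀ 2 zero_le ?_
        rw [hα hα0, hβ' hβ]
        exact pow_lt_pow_right₀ hx (by omega)

theorem IsPointed.mem_iff {V : ValuationSubring L} (hE : E.IsPointed V)
    (hV : ∀ a : K, algebraMap K L a ∈ V) {α β m : K[X]} (hm : m ≠ 0) {f : L}
    (e : aeval E.x m * f = aeval E.x α + aeval E.x β * E.y) (h : α ≠ 0 ∨ β ≠ 0) :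
    f ∈ V ↔ poleOrder g α β ≤ 2 * m.natDegree := by
  have hx := one_lt_valuation hE.pole
  have h1 := congrArg (fun z => V.valuation z ^ 2) e
  simp only [map_mul, mul_pow] at h1
  rw [hE.valuation_sq hV h, valuation_aeval hV hx hm, ← pow_mul, mul_comm _ 2] at h1
  have hpos : 0 < V.valuation E.x ^ (2 * m.natDegree) := pow_pos (zero_lt_one.trans hx) _
  rw [← V.valuation_le_one_iff, ← pow_le_one_iff_of_nonneg zero_le two_ne_zero,
    ← pow_le_pow_iff_right₀ hx, ← h1]
  exact (mul_le_iff_le_one_right hpos).symm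

/-- The curve has only one point at infinity. -/
theorem IsPointed.eq_of_isPointed {V W : ValuationSubring L} (hV : ∀ a : K, algebraMap K L a ∈ V)
    (hW : ∀ a : K, algebraMap K L a ∈ W) (hEV : E.IsPointed V) (hEW : E.IsPointed W) : V = W := by
  ext f
  obtain ⟨α, β, m, hm, e⟩ := hEV.exists_eq_div f
  by_cases h : α ≠ 0 ∨ β ≠ 0
  · rw [hEV.mem_iff hV hm e h, hEW.mem_iff hW hm e h]
  · push Not at h
    have hm' : aeval E.x m ≠ 0 := fun h => hm (E.aeval_x_eq_zero.mp h)
    have : f = 0 := by simpa [h.1, h.2, hm'] using e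
    simp [this, V.zero_mem, W.zero_mem]

theorem IsPointed.of_not_mem {V : ValuationSubring L} (hE : E.IsPointed w₀) (h : E.x ∉ V) :
    E.IsPointed V :=
  ⟨hE.natDegree_Q_le, hE.monic_P, hE.natDegree_P, h⟩

end FunctionField

end WeierstrassEquation

theorem natDegree_eq_of_monic {R : Type*} [CommRing R] {g : ℕ} {P Q H : R[X]} (hQ : Q.natDegree ≤ g) (hP : P.Monic)
    (hPd : P.natDegree = 2 * g + 1) (hH : H.natDegree ≤ g) :
    (P + Q * H - H ^ 2).Monic ∧ (P + Q * H - H ^ 2).natDegree = 2 * g + 1 := by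
  have h : (Q * H - H ^ 2).natDegree < P.natDegree := by
    refine lt_of_le_of_lt (b := 2 * g) ?_ (by omega)
    refine (natDegree_sub_le_of_le (natDegree_mul_le_of_le hQ hH)
      (natDegree_pow_le_of_le 2 hH)).trans ?_
    rw [max_le_iff]
    omega
  rw [add_sub_assoc]
  exact ⟨hP.add_of_left (degree_lt_degree h),
    by rw [natDegree_add_eq_left_of_natDegree_lt h, hPd]⟩

namespace WeierstrassEquation

/-! ### Functions regular away from `w₀` and changes of pointed equation -/

section FunctionField

variable {K L : Type*} [Field K] [Field L] [Algebra K L] {g : ℕ}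
  {E : WeierstrassEquation K K L g} {w₀ : ValuationSubring L}

/-- The element f is the fraction r/m, and K[X] is integrally closed in its fraction field. -/
theorem dvd_of_isIntegralElem {x : L} (hx : Function.Injective (aeval x : K[X] →ₐ[K] L))
    {f : L} (hf : (aeval x : K[X] →ₐ[K] L).toRingHom.IsIntegralElem f) {m r : K[X]} (hm : m ≠ 0)
    (e : aeval x m * f = aeval x r) : m ∣ r := by
  let F := FractionRing K[X]
  let ι : F →+* L := IsFractionRing.lift (g := (aeval x : K[X] →ₐ[K] L).toRingHom) hx
  have hι : ι.comp (algebraMap K[X] F) = (aeval x : K[X] →ₐ[K] L).toRingHom :=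
    RingHom.ext fun p => IsFractionRing.lift_algebraMap hx p
  have hι' : ∀ p, ι (algebraMap K[X] F p) = aeval x p := fun p => congrArg (· p) hι
  have hmF : algebraMap K[X] F m ≠ 0 := by
    rwa [Ne, map_eq_zero_iff _ (IsFractionRing.injective K[X] F)]
  have hmL : aeval x m ≠ 0 := by rwa [Ne, map_eq_zero_iff _ hx]
  obtain ⟨p, hp, hpf⟩ := hf
  have hint : IsIntegral K[X] (algebraMap K[X] F r / algebraMap K[X] F m) := by
    refine ⟨p, hp, ι.injective ?_⟩
    rw [hom_eval₂, hι, map_zero, map_div₀, hι', hι', ← e, mul_div_cancel_left₀ _ hmL]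
    exact hpf
  obtain ⟨s, hs⟩ := IsIntegrallyClosed.isIntegral_iff.mp hint
  refine ⟨s, IsFractionRing.injective K[X] F ?_⟩
  rw [map_mul, hs, mul_div_cancel₀ _ hmF]

/-- A relation satisfied by `y` is also satisfied by its conjugate `-Q(x) - y`. -/
theorem IsPointed.eval₂_conj (hE : E.IsPointed w₀) {p : K[X][X]}
    (hp : p.eval₂ (aeval E.x : K[X] →ₐ[K] L).toRingHom E.y = 0) :
    p.eval₂ (aeval E.x : K[X] →ₐ[K] L).toRingHom (-aeval E.x E.Q - E.y) = 0 := by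
  have hmonic : (X ^ 2 + (C E.Q * X - C E.P) : K[X][X]).Monic := by
    refine monic_X_pow_add (lt_of_le_of_lt (b := (1 : WithBot ℕ)) ?_ (by norm_num))
    refine (degree_sub_le _ _).trans (max_le (degree_C_mul_X_le _) ?_)
    exact degree_C_le.trans (by norm_num)
  have hdeg : (X ^ 2 + (C E.Q * X - C E.P) : K[X][X]).natDegree = 2 := by
    refine natDegree_eq_of_degree_eq_some ?_
    rw [degree_add_eq_left_of_degree_lt] <;> rw [degree_X_pow]
    · refine lt_of_le_of_lt (b := (1 : WithBot ℕ)) ?_ (by norm_num)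
      refine (degree_sub_le _ _).trans (max_le (degree_C_mul_X_le _) ?_)
      exact degree_C_le.trans (by norm_num)
  have hsplit := modByMonic_add_div p (X ^ 2 + (C E.Q * X - C E.P))
  obtain ⟨b, a, hr⟩ := exists_eq_X_add_C_of_natDegree_le_one
    (Nat.lt_succ_iff.mp (by
      have := natDegree_modByMonic_lt p hmonic (fun h => by simp [h] at hdeg)
      rwa [hdeg] at this))
  rw [hr] at hsplit
  rw [← hsplit] at hp ⊢
  have e0 := E.equation
  have e1 : aeval E.x a + aeval E.x b * E.y = 0 := by
    rw [eval₂_add, eval₂_mul] at hp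
    simp only [eval₂_add, eval₂_mul, eval₂_sub, eval₂_C, eval₂_X, eval₂_pow] at hp
    have hz : E.y ^ 2 + (aeval E.x E.Q * E.y - aeval E.x E.P) = 0 := by linear_combination e0
    simp only [AlgHom.toRingHom_eq_coe, RingHom.coe_coe] at hp
    rw [hz, zero_mul, add_zero] at hp
    linear_combination hp
  obtain ⟨rfl, rfl⟩ := hE.linearIndependent e1
  rw [eval₂_add, eval₂_mul]
  simp only [eval₂_add, eval₂_mul, eval₂_sub, eval₂_C, eval₂_X, eval₂_pow]
  simp only [AlgHom.toRingHom_eq_coe, RingHom.coe_coe]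
  have hz : (-aeval E.x E.Q - E.y) ^ 2 + (aeval E.x E.Q * (-aeval E.x E.Q - E.y) -
      aeval E.x E.P) = 0 := by linear_combination e0
  rw [hz]
  simp

/-- Conjugation fixes K[x], so the conjugate satisfies the same integral equation. `scaleRoots`
clears the denominator m, turning that equation into a polynomial relation for y to which
`IsPointed.eval₂_conj` applies. -/
theorem IsPointed.isIntegralElem_conj (hE : E.IsPointed w₀) {α β m : K[X]} (hm : m ≠ 0) {f : L}
    (hf : (aeval E.x : K[X] →ₐ[K] L).toRingHom.IsIntegralElem f)
    (e : aeval E.x m * f = aeval E.x α + aeval E.x β * E.y) :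
    (aeval E.x : K[X] →ₐ[K] L).toRingHom.IsIntegralElem
      ((aeval E.x α + aeval E.x β * (-aeval E.x E.Q - E.y)) / aeval E.x m) := by
  obtain ⟨p, hp, hpf⟩ := hf
  refine ⟨p, hp, ?_⟩
  have hmL : aeval E.x m ≠ 0 := fun h => hm (E.aeval_x_eq_zero.mp h)
  set φ := (aeval E.x : K[X] →ₐ[K] L).toRingHom with hφ
  have hφ' : ∀ q, φ q = aeval E.x q := fun _ => rfl
  have key : ∀ z : L, (eval₂ C (C α + C β * X) (scaleRoots p m)).eval₂ φ z =
      eval₂ φ (φ α + φ β * z) (scaleRoots p m) := by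
    intro z
    have h1 : (eval₂RingHom φ z).comp C = φ := by ext <;> simp
    have := hom_eval₂ (scaleRoots p m) C (eval₂RingHom φ z) (C α + C β * X)
    rw [h1] at this
    simpa using this
  have h1 := scaleRoots_eval₂_mul (p := p) φ f m
  rw [hφ', e, hpf, mul_zero] at h1
  have h2 := hE.eval₂_conj ((key E.y).trans h1)
  rw [← hφ, key] at h2
  have h3 := scaleRoots_eval₂_mul (p := p) φ
    ((aeval E.x α + aeval E.x β * (-aeval E.x E.Q - E.y)) / aeval E.x m) m
  rw [hφ' m, mul_div_cancel₀ _ hmL] at h3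
  exact (mul_eq_zero.mp (h3.symm.trans h2)).resolve_left (pow_ne_zero _ hmL)

/-- The integral closure of `K[x]` in the function field is `K[x] + K[x] y`. -/
theorem IsPointed.exists_of_isIntegralElem (hE : E.IsPointed w₀) {f : L}
    (hf : (aeval E.x : K[X] →ₐ[K] L).toRingHom.IsIntegralElem f) :
    ∃ α β : K[X], f = aeval E.x α + aeval E.x β * E.y := by
  obtain ⟨α, β, m, hm, e⟩ := hE.exists_eq_div f
  have hf' := hE.isIntegralElem_conj hm hf e
  have hmL : aeval E.x m ≠ 0 := fun h => hm (E.aeval_x_eq_zero.mp h)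
  -- Trace and norm of f are integral over K[x] and lie in K(x), hence are polynomials; smoothness
  -- then lets m be cancelled.
  have h1 : m ∣ 2 * α - β * E.Q := by
    refine dvd_of_isIntegralElem E.aeval_x_injective (RingHom.IsIntegralElem.add _ hf hf') hm ?_
    field_simp
    simp only [map_sub, map_mul, map_ofNat]
    linear_combination e
  have h2 : m ^ 2 ∣ α ^ 2 - α * β * E.Q - β ^ 2 * E.P := by
    refine dvd_of_isIntegralElem E.aeval_x_injective (RingHom.IsIntegralElem.mul _ hf hf')
      (pow_ne_zero 2 hm) ?_
    rw [← conj_eq, ← e, map_pow]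
    field_simp
  obtain ⟨⟨α, rfl⟩, ⟨β, rfl⟩⟩ := dvd_of_sq_dvd_norm E.natDegree_Q_le E.natDegree_P_le
    E.disc_ne_zero hm h1 h2
  refine ⟨α, β, mul_left_cancel₀ hmL ?_⟩
  rw [e, map_mul, map_mul]
  ring

/-- A function that is contained in all valuation rings that contain `K[x]` is integral
over `K[x]`. -/
theorem isIntegralElem_of_forall_mem {x f : L}
    (h : ∀ V : ValuationSubring L, (∀ p : K[X], aeval x p ∈ V) → f ∈ V) :
    (aeval x : K[X] →ₐ[K] L).toRingHom.IsIntegralElem f := by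
  set φ := (aeval x : K[X] →ₐ[K] L).toRingHom with hφ
  have h1 : f ∈ (⨅ V : {V : ValuationSubring L // (φ.range : Set L) ⊆ V.toSubring},
      V.1.toSubring) := by
    rw [Subring.mem_iInf]
    rintro ⟨V, hV⟩
    exact h V fun p => hV ⟨p, rfl⟩
  rw [iInf_valuationSubring_superset] at h1
  obtain ⟨p, hp, hpf⟩ := h1
  have hl : p.map (algebraMap _ L) ∈ lifts φ := by
    rw [lifts_iff_coeff_lifts]
    intro n
    rw [coeff_map]
    have := (p.coeff n).2
    exact (Subring.closure_eq φ.range).le this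
  obtain ⟨q, hq, -, hqm⟩ := lifts_and_natDegree_eq_and_monic hl (hp.map _)
  refine ⟨q, hqm, ?_⟩
  rw [← eval_map, hq, eval_map]
  exact hpf

theorem y_mem_of_x_mem {V : ValuationSubring L} (E : WeierstrassEquation K K L g)
    (hV : ∀ a : K, algebraMap K L a ∈ V) (hx : E.x ∈ V) : E.y ∈ V := by
  have hmem : ∀ p : K[X], aeval E.x p ∈ V := by
    intro p
    rw [aeval_eq_sum_range]
    refine sum_mem fun i _ => ?_
    rw [Algebra.smul_def]
    exact mul_mem (hV _) (pow_mem hx _)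
  by_contra hy
  have h1 := one_lt_valuation hy
  have h2 : V.valuation (E.y ^ 2) ≤ V.valuation E.y := by
    rw [show E.y ^ 2 = aeval E.x E.P - aeval E.x E.Q * E.y by linear_combination E.equation]
    refine Valuation.map_sub_le _ (((V.valuation_le_one_iff _).mpr (hmem _)).trans h1.le) ?_
    rw [map_mul]
    exact mul_le_of_le_one_left' ((V.valuation_le_one_iff _).mpr (hmem _))
  rw [map_pow] at h2
  exact absurd h2 (not_le.mpr (lt_self_pow₀ h1 (by norm_num)))

/-- A valuation ring containing K but not x' is the unique pole `w₀` of x'. It cannot contain x, so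
x' and y' lie in every valuation ring containing K[x]. -/
theorem IsPointed.exists_polynomials {E' : WeierstrassEquation K K L g}
    (hw : ∀ a : K, algebraMap K L a ∈ w₀) (hE : E.IsPointed w₀) (hE' : E'.IsPointed w₀) :
    (∃ α β : K[X], E'.x = aeval E.x α + aeval E.x β * E.y) ∧
      ∃ α β : K[X], E'.y = aeval E.x α + aeval E.x β * E.y := by
  have key : ∀ V : ValuationSubring L, (∀ p : K[X], aeval E.x p ∈ V) →
      (∀ a : K, algebraMap K L a ∈ V) ∧ E'.x ∈ V := by
    intro V hV
    have hVK : ∀ a : K, algebraMap K L a ∈ V := fun a => by simpa using hV (C a)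
    refine ⟨hVK, by_contra fun h => ?_⟩
    have := (hE'.of_not_mem h).eq_of_isPointed hVK hw hE'
    exact hE.pole (this ▸ by simpa using hV X)
  exact ⟨hE.exists_of_isIntegralElem (isIntegralElem_of_forall_mem fun V hV => (key V hV).2),
    hE.exists_of_isIntegralElem (isIntegralElem_of_forall_mem fun V hV =>
      E'.y_mem_of_x_mem (key V hV).1 (key V hV).2)⟩

/-- Positive genus enters here: for g = 0 the function y would have a simple pole. -/
theorem poleOrder_ne_one (hg : 1 ≤ g) (α β : K[X]) : poleOrder g α β ≠ 1 := by
  unfold poleOrder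
  split_ifs <;> omega

/-- The pole orders of x' with respect to x and of x with respect to x' have product 4, and neither
is 1, so both are 2 and x' is linear in x. Then y' has pole order 2g+1, which makes the coefficient
of y constant and bounds the degree of the other term by g. -/
theorem IsPointed.exists_linear {E' : WeierstrassEquation K K L g} (hg : 1 ≤ g)
    (hw : ∀ a : K, algebraMap K L a ∈ w₀) (hE : E.IsPointed w₀) (hE' : E'.IsPointed w₀) :
    (∃ e b : K, e ≠ 0 ∧ E'.x = algebraMap K L e * E.x + algebraMap K L b) ∧
      ∃ (f : K) (H : K[X]), f ≠ 0 ∧ H.natDegree ≤ g ∧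
        E'.y = algebraMap K L f * E.y + aeval E.x H := by
  obtain ⟨⟨α, β, hx⟩, α₁, β₁, hy⟩ := hE.exists_polynomials hw hE'
  obtain ⟨⟨α', β', hx'⟩, -⟩ := hE'.exists_polynomials hw hE
  have h1 := one_lt_valuation hE.pole
  have h1' := one_lt_valuation hE'.pole
  have hne : α ≠ 0 ∨ β ≠ 0 := by
    by_contra h
    push Not at h
    rw [h.1, h.2] at hx
    refine E'.transcendental_x ?_
    rw [hx]
    simpa using isAlgebraic_zero
  have hne' : α' ≠ 0 ∨ β' ≠ 0 := by
    by_contra h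
    push Not at h
    rw [h.1, h.2] at hx'
    refine E.transcendental_x ?_
    rw [hx']
    simpa using isAlgebraic_zero
  have hv := hE.valuation_sq hw hne
  have hv' := hE'.valuation_sq hw hne'
  rw [← hx] at hv
  rw [← hx'] at hv'
  have h4 : poleOrder g α β * poleOrder g α' β' = 4 := by
    have : w₀.valuation E.x ^ (poleOrder g α β * poleOrder g α' β') = w₀.valuation E.x ^ 4 := by
      rw [pow_mul, ← hv, ← pow_mul, mul_comm, pow_mul, ← hv', ← pow_mul]
    exact pow_right_injective₀ (zero_lt_one.trans h1) h1.ne' this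
  have h2 : poleOrder g α β = 2 := by
    have hd : poleOrder g α β ∣ 4 := Dvd.intro _ h4
    have := poleOrder_ne_one hg α β
    have := poleOrder_ne_one hg α' β'
    have hle := Nat.le_of_dvd (by norm_num) hd
    interval_cases poleOrder g α β <;> omega
  have hxx : w₀.valuation E'.x = w₀.valuation E.x := by
    rw [h2] at hv
    exact (pow_left_inj₀ zero_le zero_le two_ne_zero).mp hv
  have hy2 := hE'.valuation_y hw
  have hβ : β = 0 := by
    by_contra hβ
    rw [poleOrder, if_neg hβ] at h2
    omega
  have hne1 : α₁ ≠ 0 ∨ β₁ ≠ 0 := by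
    by_contra h
    push Not at h
    rw [hy, h.1, h.2] at hy2
    have : w₀.valuation E'.x ^ (2 * g + 1) = 0 := by rw [← hy2]; simp
    exact (pow_pos (zero_lt_one.trans h1') _).ne' this
  have h5 : poleOrder g α₁ β₁ = 2 * g + 1 := by
    have := hE.valuation_sq hw hne1
    rw [← hy, hy2, hxx] at this
    exact (pow_right_injective₀ (zero_lt_one.trans h1) h1.ne' this).symm
  constructor
  · rw [poleOrder, if_pos hβ] at h2
    obtain ⟨e, b, rfl⟩ := exists_eq_X_add_C_of_natDegree_le_one (p := α) (by omega)
    refine ⟨e, b, fun he => ?_, ?_⟩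
    · subst he
      simp at h2
    · rw [hx, hβ]
      simp
  · have hβ1 : β₁ ≠ 0 := by
      intro h
      rw [poleOrder, if_pos h] at h5
      omega
    rw [poleOrder, if_neg hβ1] at h5
    obtain ⟨f, rfl⟩ := natDegree_eq_zero.mp (show β₁.natDegree = 0 by omega)
    refine ⟨f, α₁, fun hf => hβ1 (by simp [hf]), by omega, ?_⟩
    rw [hy]
    simp [add_comm]

/-- Two pointed Weierstrass equations of the same curve differ by a change of variables
`x = u² x' + b`, `y + H(x) = u^{2g+1} y'`. -/
theorem IsPointed.exists_change {E' : WeierstrassEquation K K L g} (hg : 1 ≤ g)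
    (hw : ∀ a : K, algebraMap K L a ∈ w₀) (hE : E.IsPointed w₀) (hE' : E'.IsPointed w₀) :
    ∃ (u b : K) (H : K[X]), u ≠ 0 ∧ H.natDegree ≤ g ∧
      C (u ^ (2 * g + 1)) * E'.Q = (E.Q - 2 * H).comp (C (u ^ 2) * X + C b) ∧
      C (u ^ (4 * g + 2)) * E'.P = (E.P + E.Q * H - H ^ 2).comp (C (u ^ 2) * X + C b) := by
  obtain ⟨⟨e, b, he, hx⟩, -⟩ := hE'.exists_linear hg hw hE
  obtain ⟨-, f, G, hf, hG, hy⟩ := hE.exists_linear hg hw hE'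
  set H := C f⁻¹ * G with hH
  have hHd : H.natDegree ≤ g := (natDegree_C_mul_le _ _).trans hG
  have hfL : algebraMap K L f ≠ 0 := (_root_.map_ne_zero _).mpr hf
  have hcomp : ∀ p : K[X], aeval E'.x (p.comp (C e * X + C b)) = aeval E.x p := by
    intro p
    rw [aeval_comp]
    simp [← hx]
  have hy' : algebraMap K L f⁻¹ * E'.y = E.y + aeval E.x H := by
    rw [hH, hy, map_mul, aeval_C, map_inv₀]
    field_simp
  have hE1 : (E.y + aeval E.x H) ^ 2 + aeval E.x (E.Q - 2 * H) * (E.y + aeval E.x H) =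
      aeval E.x (E.P + E.Q * H - H ^ 2) := by
    simp only [map_add, map_sub, map_mul, map_pow, map_ofNat]
    linear_combination E.equation
  set k := f⁻¹ with hk
  have hk0 : k ≠ 0 := inv_ne_zero hf
  have hlin : C (k ^ 2) * E'.P = (E.P + E.Q * H - H ^ 2).comp (C e * X + C b) ∧
      -(C (k ^ 2) * E'.Q) = -(C k * (E.Q - 2 * H).comp (C e * X + C b)) := by
    refine hE'.linearIndependent' ?_
    simp only [map_neg, map_mul, aeval_C, hcomp]
    rw [← hE1, ← hy', map_pow]
    linear_combination -algebraMap K L k ^ 2 * E'.equation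
  have hP := hlin.1
  have hQ : C k * E'.Q = (E.Q - 2 * H).comp (C e * X + C b) := by
    have hCk : (C k : K[X]) ≠ 0 := C_ne_zero.mpr hk0
    refine mul_left_cancel₀ hCk ?_
    rw [← neg_inj.mp hlin.2, ← mul_assoc, ← C_mul, sq]
  obtain ⟨hm, hd⟩ := natDegree_eq_of_monic hE.natDegree_Q_le hE.monic_P hE.natDegree_P hHd
  -- Both right-hand sides are monic. It follows that u = k / e^g satisfies u² = e and u^(2g+1) = k.
  have hlead : k ^ 2 = e ^ (2 * g + 1) := by
    have := congrArg (coeff · (2 * g + 1)) hP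
    simp only [coeff_comp_linear hd.le, coeff_C_mul] at this
    rw [← hd, hm.coeff_natDegree, hd, ← hE'.natDegree_P, hE'.monic_P.coeff_natDegree,
      hE'.natDegree_P] at this
    simpa using this
  have hu2 : (k / e ^ g) ^ 2 = e := by
    rw [div_pow, hlead, ← pow_mul, pow_succ, mul_comm g 2]
    field_simp
  have huk : (k / e ^ g) ^ (2 * g + 1) = k := by
    rw [pow_succ, pow_mul, hu2]
    field_simp
  refine ⟨k / e ^ g, b, H, div_ne_zero hk0 (pow_ne_zero _ he), hHd, ?_, ?_⟩
  · rw [hu2, huk, hQ]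
  · rw [hu2, show 4 * g + 2 = (2 * g + 1) * 2 by ring, pow_mul, huk, hP]

end FunctionField

end WeierstrassEquation

/-- The change of the discriminant under `x = e x' + b`, `y + H(x) = k y'`. -/
theorem pow_mul_disc {R : Type*} [CommRing R] {g : ℕ} {Q P H Q' P' : R[X]}
    (hQ : Q.natDegree ≤ g + 1) (hP : P.natDegree ≤ 2 * g + 2) (hH : H.natDegree ≤ g + 1)
    (hQ' : Q'.natDegree ≤ g + 1) (hP' : P'.natDegree ≤ 2 * g + 2) {k e b : R}
    (h1 : C k * Q' = (Q - 2 * H).comp (C e * X + C b))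
    (h2 : C (k ^ 2) * P' = (P + Q * H - H ^ 2).comp (C e * X + C b)) :
    k ^ (4 * (2 * g + 1)) * disc g Q' P' = e ^ ((2 * g + 2) * (2 * g + 1)) * disc g Q P := by
  rw [← disc_C_mul g hQ' hP', h1, h2, disc_comp_linear g (natDegree_sub_two_mul_le hQ hH)
    (natDegree_add_mul_sub_sq_le (n := g + 1) hQ hP hH), disc_sub_two_mul g hQ hP hH]

/-! ### Integrality of changes of variables -/

section Integrality

/-- The polynomial `e^n p(X / e)`, for `p` of degree at most `n`. -/
noncomputable def rescale {R : Type*} [CommRing R] (e : R) (n : ℕ) (p : R[X]) : R[X] :=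
  ∑ i ∈ Finset.range (n + 1), C (e ^ (n - i) * p.coeff i) * X ^ i

theorem coeff_rescale {R : Type*} [CommRing R] (e : R) (n : ℕ) (p : R[X]) (i : ℕ) :
    (rescale e n p).coeff i = if i < n + 1 then e ^ (n - i) * p.coeff i else 0 := by
  simp only [rescale, finsetSum_coeff, coeff_C_mul_X_pow]
  simp

theorem natDegree_rescale_le {R : Type*} [CommRing R] (e : R) (n : ℕ) (p : R[X]) :
    (rescale e n p).natDegree ≤ n := by
  refine natDegree_sum_le_of_forall_le _ _ fun i hi => ?_
  have := Finset.mem_range.mp hi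
  exact (natDegree_C_mul_X_pow_le _ _).trans (by omega)

theorem map_rescale {R S : Type*} [CommRing R] [CommRing S] (φ : R →+* S) (e : R) (n : ℕ)
    (p : R[X]) : (rescale e n p).map φ = rescale (φ e) n (p.map φ) := by
  ext i
  simp only [coeff_map, coeff_rescale]
  split_ifs <;> simp

theorem rescale_zero_of_monic {R : Type*} [CommRing R] {p : R[X]} (hp : p.Monic) :
    rescale 0 p.natDegree p = X ^ p.natDegree := by
  ext i
  rw [coeff_rescale, coeff_X_pow]
  by_cases h : i = p.natDegree
  · subst h
    simp [hp]
  · rw [if_neg h]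
    split_ifs with h'
    · rw [zero_pow (by omega), zero_mul]
    · rfl

theorem rescale_eq_comp {K : Type*} [Field K] {e : K} (he : e ≠ 0) {n : ℕ} {p : K[X]}
    (hp : p.natDegree ≤ n) : rescale e n p = C (e ^ n) * p.comp (C e⁻¹ * X) := by
  ext i
  rw [coeff_rescale, coeff_C_mul, comp_C_mul_X_coeff]
  split_ifs with h
  · rw [← pow_mul_pow_sub e (show i ≤ n by omega), inv_pow]
    have := pow_ne_zero i he
    field_simp
  · rw [coeff_eq_zero_of_natDegree_lt (by omega)]
    ring

/-- The i-th coefficient is e^(n-i) d^i times that of p, and d divides e. -/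
theorem C_pow_dvd_rescale_comp {R : Type*} [CommRing R] {d e : R} (h : d ∣ e) (n : ℕ) (p : R[X]) :
    C (d ^ n) ∣ (rescale e n p).comp (C d * X) := by
  rw [C_dvd_iff_dvd_coeff]
  intro i
  rw [comp_C_mul_X_coeff, coeff_rescale]
  split_ifs with h'
  · rw [← pow_sub_mul_pow d (show i ≤ n by omega)]
    exact mul_dvd_mul (dvd_mul_of_dvd_left (pow_dvd_pow_of_dvd h _) _) dvd_rfl
  · simp

variable {O K : Type*} [CommRing O] [Field K] [Algebra O K] [IsFractionRing O K]

/-- F is integral over O[X], hence its coefficients are integral over the integrally closed ring O.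
-/
theorem exists_map_eq_of_quadratic [IsIntegrallyClosed O] {F : K[X]} {B D : O[X]}
    (h : F ^ 2 = B.map (algebraMap O K) * F + D.map (algebraMap O K)) :
    ∃ F' : O[X], F'.map (algebraMap O K) = F := by
  let := Polynomial.algebra O K
  have hint : IsIntegral O[X] F := by
    refine ⟨X ^ 2 - (C B * X + C D), ?_, ?_⟩
    · refine monic_X_pow_sub (lt_of_le_of_lt (b := (1 : WithBot ℕ)) ?_ (by norm_num))
      refine (degree_add_le _ _).trans (max_le (degree_C_mul_X_le _) ?_)
      exact degree_C_le.trans (by norm_num)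
    · simp only [eval₂_sub, eval₂_add, eval₂_mul, eval₂_C, eval₂_X, eval₂_pow]
      rw [h, algebraMap_def, coe_mapRingHom]
      ring
  have hc := Polynomial.isIntegral_iff_isIntegral_coeff.mp hint
  have : F ∈ lifts (algebraMap O K) := by
    rw [lifts_iff_coeff_lifts]
    exact fun n => IsIntegrallyClosed.isIntegral_iff.mp (hc n)
  exact (mem_lifts _).mp this

/-- The first relation makes G² divisible by ε, so G vanishes over the residue field. Cancelling ε
from combinations of the relations, and from the derivative of the first, expresses 2(P' - P) and
the derivative of P' - P through G and its derivative. Both therefore reduce to zero; evaluation at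
0 gives 2 = 0 and 2g+1 = 0. -/
theorem no_translation_mod_maximalIdeal [IsDomain O] [IsLocalRing O] {g : ℕ} (hg : 1 ≤ g) {ε : O}
    (hε : ε ∈ IsLocalRing.maximalIdeal O) (hε0 : ε ≠ 0) {Q Q' P P' G : O[X]}
    (hP : P.map (IsLocalRing.residue O) = X ^ (2 * g + 1))
    (hP' : P'.map (IsLocalRing.residue O) = (X - 1) ^ (2 * g + 1))
    (h1 : C ε * P' = C ε * P + C ε * Q * G - G ^ 2) (h2 : C ε * Q' = C ε * Q - 2 * G) : False := by
  set φ := IsLocalRing.residue O with hφ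
  have hε' : φ ε = 0 := IsLocalRing.residue_eq_zero_iff ε |>.mpr hε
  have hG : G.map φ = 0 := by
    have := congrArg (Polynomial.map φ) h1
    simp only [Polynomial.map_sub, Polynomial.map_add, Polynomial.map_mul, map_C, hε', C_0,
      zero_mul, zero_add, zero_sub, Polynomial.map_pow] at this
    exact pow_eq_zero_iff two_ne_zero |>.mp (neg_eq_zero.mp this.symm)
  have hCε : (C ε : O[X]) ≠ 0 := C_ne_zero.mpr hε0
  have h3 : 2 * (P' - P) = (Q + Q') * G := by
    refine mul_left_cancel₀ hCε ?_
    linear_combination 2 * h1 - G * h2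
  have h4 : derivative (P' - P) = derivative Q * G + Q' * derivative G := by
    refine mul_left_cancel₀ hCε ?_
    have := congrArg derivative h1
    simp only [derivative_sub, derivative_add, derivative_mul, derivative_pow, derivative_C,
      zero_mul, zero_add] at this
    rw [derivative_sub]
    simp only [Nat.cast_ofNat, map_ofNat, Nat.add_one_sub_one, pow_one] at this
    linear_combination this - derivative G * h2
  have h5 : (2 : IsLocalRing.ResidueField O) = 0 := by
    have := congrArg (fun p => eval 0 (Polynomial.map φ p)) h3
    simp [hG, hP, hP'] at this
    simpa [Odd.neg_one_pow (⟨g, rfl⟩ : Odd (2 * g + 1))] using this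
  have h6 : ((2 * g + 1 : ℕ) : IsLocalRing.ResidueField O) = 0 := by
    have := congrArg (Polynomial.map φ) h4
    rw [← derivative_map, Polynomial.map_sub, hP, hP', Polynomial.map_add, Polynomial.map_mul,
      Polynomial.map_mul, ← derivative_map G, hG] at this
    have := congrArg (eval 0) this
    simp [derivative_pow, show g ≠ 0 by omega] at this
    simpa using this
  push_cast at h6
  rw [h5] at h6
  simp at h6

/-- A change of variables `x = x' + b`, `y + H(x) = y'` between integral pointed equations is
integral. -/
theorem exists_integral_translation [IsDomain O] [ValuationRing O] {g : ℕ} (hg : 1 ≤ g)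
    {Q Q' P P' : O[X]} (hQ : Q.natDegree ≤ g) (hQ' : Q'.natDegree ≤ g) (hP : P.Monic)
    (hPd : P.natDegree = 2 * g + 1) (hP' : P'.Monic) (hPd' : P'.natDegree = 2 * g + 1)
    {b : K} {H : K[X]}
    (h1 : Q'.map (algebraMap O K) = (Q.map (algebraMap O K) - 2 * H).comp (X + C b))
    (h2 : P'.map (algebraMap O K) =
      (P.map (algebraMap O K) + Q.map (algebraMap O K) * H - H ^ 2).comp (X + C b)) :
    ∃ (b' : O) (H' : O[X]), algebraMap O K b' = b ∧ H'.map (algebraMap O K) = H := by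
  have hinj := IsFractionRing.injective O K
  have hb : ∃ b' : O, algebraMap O K b' = b := by
    by_contra hb
    -- If b is not in the valuation ring, its inverse ε is, and ε is not a unit.
    obtain ⟨ε, hεb⟩ := (ValuationRing.isInteger_or_isInteger O b).resolve_left hb
    have hb0 : b ≠ 0 := fun h => hb ⟨0, by simp [h]⟩
    have hε0 : ε ≠ 0 := by
      rintro rfl
      rw [map_zero] at hεb
      exact inv_ne_zero hb0 hεb.symm
    have hεm : ε ∈ IsLocalRing.maximalIdeal O := by
      rw [IsLocalRing.mem_maximalIdeal, mem_nonunits_iff]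
      rintro ⟨w, rfl⟩
      refine hb ⟨(w⁻¹ : Oˣ), ?_⟩
      have : algebraMap O K ((w⁻¹ : Oˣ) : O) * algebraMap O K w = 1 := by
        rw [← map_mul]; simp
      rw [hεb] at this
      rwa [← div_eq_mul_inv, div_eq_one_iff_eq hb0] at this
    set φ := algebraMap O K with hφ
    have hφε : φ ε ≠ 0 := by rw [hεb]; exact inv_ne_zero hb0
    have hs : ∀ (n : ℕ) (p : O[X]), p.natDegree ≤ n →
        (rescale ε n p).map φ = C (φ ε ^ n) * (p.map φ).comp (C b * X) := by
      intro n p hp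
      rw [map_rescale, rescale_eq_comp hφε (natDegree_map_le.trans hp), hεb, inv_inv]
    have hs' : ∀ (n : ℕ) (p : O[X]), p.natDegree ≤ n →
        ((rescale ε n p).comp (X - 1)).map φ =
          C (φ ε ^ n) * (p.map φ).comp (C b * X - C b) := by
      intro n p hp
      rw [Polynomial.map_comp, hs n p hp, mul_comp, C_comp, comp_assoc]
      simp [mul_sub]
    have hcomp : (X + C b).comp (C b * X - C b) = C b * X := by simp
    have hQ1 : ((rescale ε g Q').comp (X - 1)).map φ =
        (rescale ε g Q).map φ - 2 * (C (φ ε ^ g) * H.comp (C b * X)) := by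
      rw [hs' g Q' hQ', h1, comp_assoc, hcomp, hs g Q hQ, sub_comp, mul_comp, ofNat_comp]
      push_cast
      ring
    have hP1 : ((rescale ε (2 * g + 1) P').comp (X - 1)).map φ =
        (rescale ε (2 * g + 1) P).map φ +
          C (φ ε ^ (g + 1)) * (rescale ε g Q).map φ * H.comp (C b * X) -
          C (φ ε ^ (2 * g + 1)) * H.comp (C b * X) ^ 2 := by
      rw [hs' _ P' hPd'.le, h2, comp_assoc, hcomp, hs _ P hPd.le, hs g Q hQ, sub_comp, add_comp,
        mul_comp, pow_comp]
      simp only [C_pow]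
      ring
    -- The natural weight of H would be ε^((2g+1)/2). Rounding the exponent up to g+1 costs the
    -- factor ε in the next two relations, and that factor is what makes G vanish modulo the maximal
    -- ideal.
    set G := C (φ ε ^ (g + 1)) * H.comp (C b * X) with hG
    have e1 : C (φ ε) * ((rescale ε (2 * g + 1) P').comp (X - 1)).map φ =
        C (φ ε) * (rescale ε (2 * g + 1) P).map φ +
          C (φ ε) * (rescale ε g Q).map φ * G - G ^ 2 := by
      rw [hP1, hG]
      simp only [C_pow]
      ring
    have e2 : C (φ ε) * ((rescale ε g Q').comp (X - 1)).map φ =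
        C (φ ε) * (rescale ε g Q).map φ - 2 * G := by
      rw [hQ1, hG]
      simp only [C_pow]
      ring
    obtain ⟨G', hG'⟩ := exists_map_eq_of_quadratic (F := G) (B := C ε * rescale ε g Q)
      (D := C ε * (rescale ε (2 * g + 1) P - (rescale ε (2 * g + 1) P').comp (X - 1))) (by
        rw [Polynomial.map_mul, Polynomial.map_mul, Polynomial.map_sub, map_C, ← hφ]
        linear_combination e1)
    rw [← hG'] at e1 e2
    have hmon : ∀ P : O[X], P.Monic → P.natDegree = 2 * g + 1 →
        (rescale ε (2 * g + 1) P).map (IsLocalRing.residue O) = X ^ (2 * g + 1) := by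
      intro P hP hd
      rw [map_rescale, (IsLocalRing.residue_eq_zero_iff ε).mpr hεm]
      have := rescale_zero_of_monic (hP.map (IsLocalRing.residue O))
      rwa [hP.natDegree_map, hd] at this
    refine no_translation_mod_maximalIdeal hg hεm hε0 (hmon P hP hPd)
      (Q := rescale ε g Q) (Q' := (rescale ε g Q').comp (X - 1))
      (P' := (rescale ε (2 * g + 1) P').comp (X - 1)) (G := G') ?_ ?_ ?_
    · rw [Polynomial.map_comp, hmon P' hP' hPd']
      simp
    · refine Polynomial.map_injective φ hinj ?_
      simpa using e1
    · refine Polynomial.map_injective φ hinj ?_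
      simpa using e2
  obtain ⟨b', rfl⟩ := hb
  -- With b integral, translating back exhibits H as a root of a monic quadratic over O[X].
  have e : H ^ 2 = Q.map (algebraMap O K) * H +
      (P - P'.comp (X - C b')).map (algebraMap O K) := by
    have hX : (X + C (algebraMap O K b') : K[X]).comp (X - C (algebraMap O K b')) = X := by simp
    have := congrArg (fun p : K[X] => p.comp (X - C (algebraMap O K b'))) h2
    simp only [comp_assoc, hX, comp_X] at this
    rw [Polynomial.map_sub, Polynomial.map_comp]
    simp only [Polynomial.map_sub, map_X, map_C]
    linear_combination this
  obtain ⟨H', hH'⟩ := exists_map_eq_of_quadratic e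
  exact ⟨b', H', rfl, hH'⟩

/-- A change of variables `x = u² x' + b`, `y + H(x) = u^{2g+1} y'` between integral pointed
equations with integral `u` is integral. -/
theorem exists_integral_change [IsDomain O] [ValuationRing O] {g : ℕ} (hg : 1 ≤ g)
    {Q Q' P P' : O[X]} (hQ : Q.natDegree ≤ g) (hQ' : Q'.natDegree ≤ g) (hP : P.Monic)
    (hPd : P.natDegree = 2 * g + 1) (hP' : P'.Monic) (hPd' : P'.natDegree = 2 * g + 1)
    {u d : O} (hu : u ≠ 0) (hd : d ∣ u) {b : K} {H : K[X]} (hH : H.natDegree ≤ g)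
    (h1 : C (algebraMap O K u ^ (2 * g + 1)) * Q'.map (algebraMap O K) =
      (Q.map (algebraMap O K) - 2 * H).comp (C (algebraMap O K u ^ 2) * X + C b))
    (h2 : C (algebraMap O K u ^ (4 * g + 2)) * P'.map (algebraMap O K) =
      (P.map (algebraMap O K) + Q.map (algebraMap O K) * H - H ^ 2).comp
        (C (algebraMap O K u ^ 2) * X + C b)) :
    ∃ (b' : O) (H' : O[X]), H'.natDegree ≤ g ∧
      C (d ^ (2 * g + 1)) ∣ (Q - 2 * H').comp (C (d ^ 2) * X + C b') ∧
      C (d ^ (4 * g + 2)) ∣ (P + Q * H' - H' ^ 2).comp (C (d ^ 2) * X + C b') := by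
  have hinj := IsFractionRing.injective O K
  set φ := algebraMap O K with hφ
  have hφu : φ u ≠ 0 := (map_ne_zero_iff _ hinj).mpr hu
  have hφu2 : φ (u ^ 2) ≠ 0 := by rw [map_pow]; exact pow_ne_zero 2 hφu
  have hlin : (C (φ u ^ 2) * X + C b).comp (C (φ u ^ 2)⁻¹ * X) = X + C b := by
    rw [add_comp, mul_comp, C_comp, C_comp, X_comp, ← mul_assoc, ← C_mul,
      mul_inv_cancel₀ (pow_ne_zero 2 hφu), C_1, one_mul]
  -- Substituting X/u² turns the change into a pure translation. Since u^(2g+1) = u (u²)^g, the new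
  -- Q is u times a rescaling, so it is still integral.
  have hQ2 : (C u * rescale (u ^ 2) g Q').map φ = (Q.map φ - 2 * H).comp (X + C b) := by
    rw [Polynomial.map_mul, map_C, map_rescale, rescale_eq_comp hφu2 (natDegree_map_le.trans hQ'),
      ← hlin, ← comp_assoc, ← h1, mul_comp, C_comp, ← mul_assoc, ← C_mul, map_pow, ← pow_mul,
      ← pow_succ']
  have hP2 : (rescale (u ^ 2) (2 * g + 1) P').map φ =
      (P.map φ + Q.map φ * H - H ^ 2).comp (X + C b) := by
    rw [map_rescale, rescale_eq_comp hφu2 (natDegree_map_le.trans hPd'.le),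
      ← hlin, ← comp_assoc, ← h2, mul_comp, C_comp, map_pow φ u 2, ← pow_mul,
      show 2 * (2 * g + 1) = 4 * g + 2 by ring]
  have hc : (rescale (u ^ 2) (2 * g + 1) P').coeff (2 * g + 1) = 1 := by
    rw [coeff_rescale, if_pos (by omega), Nat.sub_self, pow_zero, one_mul, ← hPd',
      hP'.coeff_natDegree]
  obtain ⟨b', H', rfl, rfl⟩ := exists_integral_translation hg hQ
    ((natDegree_C_mul_le _ _).trans (natDegree_rescale_le (u ^ 2) g Q')) hP hPd
    (monic_of_natDegree_le_of_coeff_eq_one _ (natDegree_rescale_le _ _ _) hc)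
    (le_antisymm (natDegree_rescale_le _ _ _)
      (le_natDegree_of_ne_zero (by rw [hc]; exact one_ne_zero))) hQ2 hP2
  refine ⟨b', H', by rwa [natDegree_map_eq_of_injective hinj] at hH, ?_, ?_⟩
  · have e : C u * rescale (u ^ 2) g Q' = (Q - 2 * H').comp (X + C b') := by
      refine Polynomial.map_injective φ hinj ?_
      rw [hQ2, Polynomial.map_comp]
      simp [hφ]
    have e' : (Q - 2 * H').comp (C (d ^ 2) * X + C b') =
        C u * (rescale (u ^ 2) g Q').comp (C (d ^ 2) * X) := by
      have := congrArg (·.comp (C (d ^ 2) * X)) e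
      simp only [mul_comp, C_comp, comp_assoc] at this
      rw [this]
      simp
    -- One factor d comes from u, the remaining (d²)^g from the rescaled polynomial.
    rw [e', show 2 * g + 1 = 1 + 2 * g by ring, pow_add, pow_one, pow_mul, C_mul]
    exact mul_dvd_mul (map_dvd C hd) (C_pow_dvd_rescale_comp (pow_dvd_pow_of_dvd hd 2) _ _)
  · have e : rescale (u ^ 2) (2 * g + 1) P' = (P + Q * H' - H' ^ 2).comp (X + C b') := by
      refine Polynomial.map_injective φ hinj ?_
      rw [hP2, Polynomial.map_comp]
      simp [hφ]
    have e' : (P + Q * H' - H' ^ 2).comp (C (d ^ 2) * X + C b') =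
        (rescale (u ^ 2) (2 * g + 1) P').comp (C (d ^ 2) * X) := by
      have := congrArg (·.comp (C (d ^ 2) * X)) e
      simp only [comp_assoc] at this
      rw [this]
      simp
    rw [e', show 4 * g + 2 = 2 * (2 * g + 1) by ring, pow_mul]
    exact C_pow_dvd_rescale_comp (pow_dvd_pow_of_dvd hd 2) _ _

end Integrality

/-! ### Descent from the localization -/

section Descent

variable {A O : Type*} [CommRing A] {𝔭 : Ideal A} [𝔭.IsMaximal] {π : A}
  [CommRing O] [Algebra A O] [IsLocalization.AtPrime O 𝔭]

theorem prime_generator (hπ : 𝔭 = Ideal.span {π}) (hπ0 : π ≠ 0) : Prime π :=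
  (Ideal.span_singleton_prime hπ0).mp (hπ ▸ ‹𝔭.IsMaximal›.isPrime)

/-- Denominators in the localization are prime to π, so they can be removed from the divisibility.
-/
theorem pow_dvd_of_algebraMap_dvd [IsDomain A] (hπ : 𝔭 = Ideal.span {π}) (hπ0 : π ≠ 0) {n : ℕ} {a : A}
    (h : algebraMap A O π ^ n ∣ algebraMap A O a) : π ^ n ∣ a := by
  obtain ⟨o, ho⟩ := h
  obtain ⟨s, t, rfl⟩ := IsLocalization.exists_mk'_eq 𝔭.primeCompl o
  have h1 : algebraMap A O (a * t) = algebraMap A O (π ^ n * s) := by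
    rw [map_mul, ho, mul_assoc, IsLocalization.mk'_spec, map_mul, map_pow]
  have h2 := IsLocalization.injective O 𝔭.primeCompl_le_nonZeroDivisors h1
  refine (prime_generator hπ hπ0).pow_dvd_of_dvd_mul_right n 
    (fun h => t.2 (hπ.ge (Ideal.mem_span_singleton.mpr h))) (Dvd.intro _ h2.symm)

theorem C_pow_dvd_of_map_dvd [IsDomain A] (hπ : 𝔭 = Ideal.span {π}) (hπ0 : π ≠ 0) {n : ℕ} {p : A[X]}
    (h : C (algebraMap A O π ^ n) ∣ p.map (algebraMap A O)) : C (π ^ n) ∣ p := by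
  rw [C_dvd_iff_dvd_coeff] at h ⊢
  intro i
  have := h i
  rw [coeff_map] at this
  exact pow_dvd_of_algebraMap_dvd hπ hπ0 this

/-- As 𝔭 is maximal, a denominator outside 𝔭 is invertible modulo π^n already in A. -/
theorem exists_pow_dvd_sub (hπ : 𝔭 = Ideal.span {π}) (n : ℕ) (o : O) :
    ∃ a : A, algebraMap A O π ^ n ∣ algebraMap A O a - o := by
  obtain ⟨s, t, rfl⟩ := IsLocalization.exists_mk'_eq 𝔭.primeCompl o
  have hcop : IsCoprime (t : A) π := by
    have h := ‹𝔭.IsMaximal›.exists_inv t.2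
    obtain ⟨y, i, hi, h⟩ := h
    rw [hπ] at hi
    obtain ⟨z, rfl⟩ := Ideal.mem_span_singleton'.mp hi
    exact ⟨y, z, h⟩
  obtain ⟨y, z, h⟩ := hcop.pow_right (n := n)
  refine ⟨s * y, -(algebraMap A O z * IsLocalization.mk' O s t), ?_⟩
  have h1 := congrArg (algebraMap A O) h
  rw [map_add, map_mul, map_mul, map_one, map_pow] at h1
  rw [map_mul]
  linear_combination IsLocalization.mk' O s t * h1 -
    algebraMap A O y * IsLocalization.mk'_spec O s t

theorem exists_C_pow_dvd_sub (hπ : 𝔭 = Ideal.span {π}) (n : ℕ) {g : ℕ} {H : O[X]}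
    (hH : H.natDegree ≤ g) :
    ∃ H' : A[X], H'.natDegree ≤ g ∧ C (algebraMap A O π ^ n) ∣ H'.map (algebraMap A O) - H := by
  choose a ha using fun o : O => exists_pow_dvd_sub hπ n o
  refine ⟨∑ i ∈ Finset.range (g + 1), C (a (H.coeff i)) * X ^ i, ?_, ?_⟩
  · refine natDegree_sum_le_of_forall_le _ _ fun i hi => ?_
    have := Finset.mem_range.mp hi
    exact (natDegree_C_mul_X_pow_le _ _).trans (by omega)
  · conv_rhs => rhs; rw [as_sum_range' H (g + 1) (by omega)]
    rw [Polynomial.map_sum, ← Finset.sum_sub_distrib]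
    refine Finset.dvd_sum fun i _ => ?_
    rw [Polynomial.map_mul, Polynomial.map_pow, map_C, map_X, ← C_mul_X_pow_eq_monomial, ← sub_mul,
      ← C_sub]
    have h := map_dvd (C : O →+* O[X]) (ha (H.coeff i))
    exact h.mul_right _

theorem dvd_comp_sub_comp {R : Type*} [CommRing R] {d : R[X]} (p : R[X]) {q r : R[X]}
    (h : d ∣ q - r) : d ∣ p.comp q - p.comp r :=
  h.trans (by simpa [comp, eval₂_eq_eval_map] using sub_dvd_eval_sub q r (p.map C))

/-- The changes of variables over the local ring can be approximated by ones over `A`. -/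
theorem exists_approximation [IsDomain A] (hπ : 𝔭 = Ideal.span {π}) (hπ0 : π ≠ 0) {g : ℕ} {Q P : A[X]}
    {b : O} {H : O[X]} (hH : H.natDegree ≤ g)
    (h1 : C (algebraMap A O π ^ (2 * g + 1)) ∣ (Q.map (algebraMap A O) - 2 * H).comp
      (C (algebraMap A O π ^ 2) * X + C b))
    (h2 : C (algebraMap A O π ^ (4 * g + 2)) ∣
      (P.map (algebraMap A O) + Q.map (algebraMap A O) * H - H ^ 2).comp
        (C (algebraMap A O π ^ 2) * X + C b)) :
    ∃ (c : A) (H' : A[X]), H'.natDegree ≤ g ∧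
      C (π ^ (2 * g + 1)) ∣ (Q - 2 * H').comp (C (π ^ 2) * X + C c) ∧
      C (π ^ (4 * g + 2)) ∣ (P + Q * H' - H' ^ 2).comp (C (π ^ 2) * X + C c) := by
  -- Precision 4g+2 suffices because both conditions only involve residues modulo powers of π up to
  -- this one.
  obtain ⟨c, hc⟩ := exists_pow_dvd_sub (O := O) hπ (4 * g + 2) b
  obtain ⟨H', hH', hHH⟩ := exists_C_pow_dvd_sub (O := O) hπ (4 * g + 2) hH
  set φ := algebraMap A O with hφ
  set N := C (φ π ^ (4 * g + 2)) with hN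
  have hlin : N ∣ (C (φ π ^ 2) * X + C (φ c)) - (C (φ π ^ 2) * X + C b) := by
    rw [add_sub_add_left_eq_sub, ← C_sub]
    exact map_dvd C hc
  have hcomp : ∀ p q : O[X], N ∣ p - q → N ∣ p.comp (C (φ π ^ 2) * X + C (φ c)) -
      q.comp (C (φ π ^ 2) * X + C b) := by
    intro p q h
    obtain ⟨r, hr⟩ := h
    rw [show p = q + N * r by rw [← hr]; ring, add_comp, add_sub_right_comm]
    refine dvd_add (dvd_comp_sub_comp q hlin) ?_
    rw [mul_comp, hN, C_comp]
    exact dvd_mul_right _ _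
  have hle : C (φ π ^ (2 * g + 1)) ∣ N := map_dvd C (pow_dvd_pow _ (by omega))
  refine ⟨c, H', hH', C_pow_dvd_of_map_dvd (O := O) hπ hπ0 ?_,
    C_pow_dvd_of_map_dvd (O := O) hπ hπ0 ?_⟩
  · rw [map_comp_linear, map_pow _ π 2, ← hφ]
    have h := hcomp ((Q - 2 * H').map φ) (Q.map φ - 2 * H) (by
      have : (Q - 2 * H').map φ - (Q.map φ - 2 * H) = -2 * (H'.map φ - H) := by
        simp; ring
      rw [this]
      exact hHH.mul_left _)
    exact (dvd_iff_dvd_of_dvd_sub (hle.trans h)).mpr h1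
  · rw [map_comp_linear, map_pow _ π 2, ← hφ]
    have h := hcomp ((P + Q * H' - H' ^ 2).map φ) (P.map φ + Q.map φ * H - H ^ 2) (by
      have : (P + Q * H' - H' ^ 2).map φ - (P.map φ + Q.map φ * H - H ^ 2) =
          (H'.map φ - H) * (Q.map φ - H'.map φ - H) := by
        simp; ring
      rw [this]
      exact hHH.mul_right _)
    exact (dvd_iff_dvd_of_dvd_sub h).mpr h2

end Descent

/-! ### Multiplicities and divisibility -/

section Multiplicity

/-- As long as p^k divides δ with k ≤ n, the term qδ is divisible by p^(2k+1), so δ² is too and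
p^(k+1) divides δ. It is applied to the difference δ of two choices of H. -/
theorem pow_dvd_of_pow_dvd_sq_sub {R : Type*} [CommRing R] [IsDomain R] {p : R} (hp : Prime p)
    {q δ : R} (n : ℕ) (hq : p ^ (n + 1) ∣ q) (h : p ^ (2 * n + 1) ∣ δ ^ 2 - q * δ) :
    p ^ (n + 1) ∣ δ := by
  have key : ∀ k ≤ n + 1, p ^ k ∣ δ := by
    intro k
    induction k with
    | zero => intro _; simp
    | succ k ih =>
      intro hk
      obtain ⟨δ', rfl⟩ := ih (by omega)
      obtain ⟨q', rfl⟩ := hq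
      have h1 : p ^ (2 * k) * p ∣ p ^ (2 * k) * (δ' ^ 2 - p ^ (n + 1 - k) * q' * δ') := by
        rw [← pow_succ]
        refine (pow_dvd_pow p (show 2 * k + 1 ≤ 2 * n + 1 by omega)).trans (h.trans (dvd_of_eq ?_))
        rw [← pow_sub_mul_pow p (show k ≤ n + 1 by omega)]
        ring
      have h2 := (mul_dvd_mul_iff_left (pow_ne_zero _ hp.ne_zero)).mp h1
      have h3 : p ∣ p ^ (n + 1 - k) * q' * δ' :=
        ((dvd_pow_self p (by omega)).mul_right _).mul_right _
      rw [pow_succ]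
      exact mul_dvd_mul_left _ (hp.dvd_of_dvd_pow ((dvd_sub_left h3).mp h2))
  exact key _ le_rfl

variable {A : Type*} [CommRing A]

/-- Writing c' = c + πt, the new substitution is the old one followed by X ↦ X + t. Hence the
multiplicity does not depend on the lift c. -/
theorem C_dvd_comp_of_mk_eq {π : A} {n : ℕ} {c c' : A}
    (h : Ideal.Quotient.mk (Ideal.span {π}) c = Ideal.Quotient.mk (Ideal.span {π}) c') {F : A[X]}
    (hF : C (π ^ n) ∣ F.comp (C π * X + C c)) : C (π ^ n) ∣ F.comp (C π * X + C c') := by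
  rw [eq_comm, Ideal.Quotient.eq, Ideal.mem_span_singleton] at h
  obtain ⟨t, ht⟩ := h
  have e : F.comp (C π * X + C c') = (F.comp (C π * X + C c)).comp (X + C t) := by
    rw [comp_assoc]
    congr 1
    rw [show c' = c + π * t by rw [← ht]; ring]
    simp
    ring
  obtain ⟨G, hG⟩ := hF
  rw [e, hG, mul_comp, C_comp]
  exact dvd_mul_right _ _

/-- The coefficients of F(πX + c) are π^i a_i, so μ_c is the Gauss valuation of this polynomial. -/
theorem natCast_le_mu_iff [IsDomain A] {π : A} (hπ0 : π ≠ 0) (n : ℕ) (c : A) (F : A[X]) :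
    (n : ℕ∞) ≤ mu π c F ↔ C (π ^ n) ∣ F.comp (C π * X + C c) := by
  rw [mu, le_iInf_iff, C_dvd_iff_dvd_coeff]
  refine forall_congr' fun i => ?_
  rw [comp_linear_eq_taylor, comp_C_mul_X_coeff]
  rcases le_total n i with h | h
  · refine iff_of_true (le_add_left (by exact_mod_cast h)) ?_
    exact dvd_mul_of_dvd_right (pow_dvd_pow _ h) _
  · rw [← pow_sub_mul_pow π h, mul_dvd_mul_iff_right (pow_ne_zero _ hπ0),
      pow_dvd_iff_le_emultiplicity]
    constructor
    · intro h'
      rw [ENat.natCast_sub]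
      exact tsub_le_iff_right.mpr h'
    · intro h'
      rw [ENat.natCast_sub] at h'
      exact tsub_le_iff_right.mp h'

theorem natCast_le_two_mul_iff (n : ℕ) (m : ℕ∞) :
    (n : ℕ∞) ≤ 2 * m ↔ (((n + 1) / 2 : ℕ) : ℕ∞) ≤ m := by
  induction m using ENat.recTopCoe with
  | top => simp
  | coe m =>
    norm_cast
    omega

theorem natCast_le_lambdaPair_iff [IsDomain A] {π : A} (hπ0 : π ≠ 0) (n : ℕ) (c : A)
    (Q P : A[X]) : (n : ℕ∞) ≤ lambdaPair π c Q P ↔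
      C (π ^ ((n + 1) / 2)) ∣ Q.comp (C π * X + C c) ∧ C (π ^ n) ∣ P.comp (C π * X + C c) := by
  rw [lambdaPair, le_min_iff, natCast_le_two_mul_iff, natCast_le_mu_iff hπ0,
    natCast_le_mu_iff hπ0]

theorem shift_comp (Q P H δ l : A[X]) :
    (Q - 2 * (H + δ)).comp l = (Q - 2 * H).comp l - 2 * δ.comp l ∧
      (P + Q * (H + δ) - (H + δ) ^ 2).comp l =
        (P + Q * H - H ^ 2).comp l + (Q - 2 * H).comp l * δ.comp l - δ.comp l ^ 2 := by
  constructor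
  · simp only [sub_comp, mul_comp, add_comp, ofNat_comp]; ring
  · simp only [sub_comp, mul_comp, add_comp, pow_comp, ofNat_comp]; ring

/-- The multiplicity does not decrease if `H` changes by a polynomial of large multiplicity. -/
theorem C_dvd_shift {π : A} {n : ℕ} {Q P H δ l : A[X]} (h1 : C (π ^ n) ∣ (Q - 2 * H).comp l)
    (h2 : C (π ^ (2 * n)) ∣ (P + Q * H - H ^ 2).comp l) (h3 : C (π ^ n) ∣ δ.comp l) :
    C (π ^ n) ∣ (Q - 2 * (H + δ)).comp l ∧
      C (π ^ (2 * n)) ∣ (P + Q * (H + δ) - (H + δ) ^ 2).comp l := by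
  rw [(shift_comp Q P H δ l).1, (shift_comp Q P H δ l).2]
  refine ⟨dvd_sub h1 (h3.mul_left _), dvd_sub (dvd_add h2 ?_) ?_⟩
  · rw [two_mul, pow_add, C_mul]
    exact mul_dvd_mul h1 h3
  · rw [two_mul, pow_add, C_mul, sq]
    exact mul_dvd_mul h3 h3

/-- The change δ from H to H' is divisible by π^(g+1), so it alters the second polynomial only
modulo π^(2g+2). Thus multiplicity 2g+2 cannot be gained by changing an H that reaches 2g+1. -/
theorem C_dvd_of_odd_multiplicity [IsDomain A] {π : A} (hπ : Prime π) {g : ℕ} {Q P H H' l : A[X]}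
    (h1 : C (π ^ (g + 1)) ∣ (Q - 2 * H).comp l)
    (h2 : C (π ^ (2 * g + 1)) ∣ (P + Q * H - H ^ 2).comp l)
    (h3 : C (π ^ (2 * g + 2)) ∣ (P + Q * H' - H' ^ 2).comp l) :
    C (π ^ (2 * g + 2)) ∣ (P + Q * H - H ^ 2).comp l := by
  have hp : Prime (C π) := prime_C_iff.mpr hπ
  obtain ⟨-, e⟩ := shift_comp Q P H (H' - H) l
  rw [add_sub_cancel] at e
  rw [e] at h3
  simp only [C_pow] at *
  set δ := (H' - H).comp l
  set q := (Q - 2 * H).comp l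
  have hδ : C π ^ (g + 1) ∣ δ := by
    refine pow_dvd_of_pow_dvd_sq_sub hp g h1 ?_
    have := dvd_sub h2 ((pow_dvd_pow (C π) (show 2 * g + 1 ≤ 2 * g + 2 by omega)).trans h3)
    convert this using 1
    ring
  have h4 : C π ^ (2 * g + 2) ∣ q * δ - δ ^ 2 := by
    rw [show 2 * g + 2 = (g + 1) + (g + 1) by ring, pow_add, sq]
    exact dvd_sub (mul_dvd_mul h1 hδ) (mul_dvd_mul hδ hδ)
  rw [add_sub_assoc] at h3
  exact (dvd_add_left h4).mp h3

/-- After division by powers of π, any better H' would give d with q' ≡ 2d and p + q'd - d² ≡ 0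
modulo π, so p ≡ -d², impossible for a monic p of odd degree. -/
theorem not_C_dvd_of_monic [IsDomain A] {π : A} (hπ : Prime π) {n : ℕ} {Q P H H' l p : A[X]}
    (hp : p.Monic) (hpd : Odd p.natDegree)
    (h1 : C (π ^ (n + 1)) ∣ (Q - 2 * H).comp l)
    (h2 : (P + Q * H - H ^ 2).comp l = C (π ^ (2 * n + 2)) * p)
    (h3 : C (π ^ (n + 2)) ∣ (Q - 2 * H').comp l)
    (h4 : C (π ^ (2 * n + 3)) ∣ (P + Q * H' - H' ^ 2).comp l) : False := by
  have hpr : Prime (C π) := prime_C_iff.mpr hπ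
  obtain ⟨e0, e⟩ := shift_comp Q P H (H' - H) l
  rw [add_sub_cancel] at e e0
  rw [e, h2] at h4
  rw [e0] at h3
  simp only [C_pow] at *
  set δ := (H' - H).comp l
  set q := (Q - 2 * H).comp l
  have hδ : C π ^ (n + 1) ∣ δ := by
    refine pow_dvd_of_pow_dvd_sq_sub hpr n h1 ?_
    have := dvd_sub ((pow_dvd_pow (C π) (show 2 * n + 1 ≤ 2 * n + 2 by omega)).trans
      (dvd_mul_right _ p)) ((pow_dvd_pow (C π) (show 2 * n + 1 ≤ 2 * n + 3 by omega)).trans h4)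
    convert this using 1
    ring
  obtain ⟨d, hd⟩ := hδ
  obtain ⟨q', hq⟩ := h1
  rw [hd, hq] at h3 h4
  have h5 : C π ∣ q' - 2 * d := by
    refine (mul_dvd_mul_iff_left (pow_ne_zero (n + 1) hpr.ne_zero)).mp ?_
    rw [← pow_succ]
    convert h3 using 1
    ring
  have h6 : C π ∣ p + q' * d - d ^ 2 := by
    refine (mul_dvd_mul_iff_left (pow_ne_zero (2 * n + 2) hpr.ne_zero)).mp ?_
    rw [← pow_succ]
    convert h4 using 1
    ring
  have h7 : C π ∣ p + d ^ 2 := by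
    have := dvd_sub h6 (h5.mul_right d)
    convert this using 1
    ring
  have : IsDomain (A ⧸ Ideal.span {π}) := by
    rw [Ideal.Quotient.isDomain_iff_prime]
    exact (Ideal.span_singleton_prime hπ.ne_zero).mpr hπ
  set φ := Ideal.Quotient.mk (Ideal.span {π})
  have hφ : φ π = 0 := Ideal.Quotient.eq_zero_iff_mem.mpr (Ideal.mem_span_singleton_self π)
  have h8 : p.map φ = -(d.map φ) ^ 2 := by
    have := Polynomial.map_dvd φ h7
    rw [map_C, hφ, C_0, zero_dvd_iff, Polynomial.map_add, Polynomial.map_pow] at this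
    exact eq_neg_of_add_eq_zero_left this
  have h9 := congrArg natDegree h8
  rw [hp.natDegree_map, natDegree_neg, natDegree_pow] at h9
  rw [h9] at hpd
  exact (Nat.not_odd_iff_even.mpr (even_two_mul _)) hpd

/-- From π^N ∣ π^(2i) a_i one gets π^(N-i) ∣ π^i a_i, and only i ≤ m occur. -/
theorem C_pow_sub_dvd_comp [IsDomain A] {π : A} (hπ0 : π ≠ 0) {F : A[X]} {c : A} {N m : ℕ}
    (hm : m ≤ N) (hF : F.natDegree ≤ m) (h : C (π ^ N) ∣ F.comp (C (π ^ 2) * X + C c)) :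
    C (π ^ (N - m)) ∣ F.comp (C π * X + C c) := by
  rw [C_dvd_iff_dvd_coeff] at h ⊢
  intro i
  have hi := h i
  rw [comp_linear_eq_taylor, comp_C_mul_X_coeff] at hi ⊢
  by_cases him : i ≤ m
  · refine (pow_dvd_pow π (show N - m ≤ N - i by omega)).trans ?_
    rw [← pow_sub_mul_pow π (show i ≤ N by omega), ← pow_mul, two_mul, pow_add, ← mul_assoc] at hi
    exact (mul_dvd_mul_iff_right (pow_ne_zero i hπ0)).mp hi
  · rw [coeff_eq_zero_of_natDegree_lt (by rw [natDegree_taylor]; omega)]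
    simp

/-- `H` may be replaced by a polynomial of degree at most `n` whose coefficient at `n` is
arbitrary. -/
theorem exists_natDegree_le_C_dvd [IsDomain A] {π : A} (c a : A) (n : ℕ) (H : A[X]) :
    ∃ δ : A[X], (H + δ).natDegree ≤ n ∧ (H + δ).coeff n = a ∧
      C (π ^ n) ∣ δ.comp (C π * X + C c) := by
  have hm : ((X - C c) ^ n : A[X]).Monic := (monic_X_sub_C c).pow n
  have hd : ((X - C c) ^ n : A[X]).natDegree = n := by simp
  have hlt : (H %ₘ (X - C c) ^ n).degree < n := by
    have := degree_modByMonic_lt H hm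
    rwa [degree_eq_natDegree hm.ne_zero, hd] at this
  -- H is reduced modulo (X-c)^n and a(X-c)^n is added. The total change is a multiple of (X-c)^n,
  -- which becomes π^n X^n under the substitution.
  refine ⟨(C a - H /ₘ (X - C c) ^ n) * (X - C c) ^ n, ?_⟩
  have e : H + (C a - H /ₘ (X - C c) ^ n) * (X - C c) ^ n =
      H %ₘ (X - C c) ^ n + C a * (X - C c) ^ n := by
    linear_combination -modByMonic_add_div H ((X - C c) ^ n)
  refine ⟨?_, ?_, ?_⟩
  · rw [e]
    refine natDegree_add_le_of_degree_le (natDegree_le_of_degree_le hlt.le) ?_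
    exact (natDegree_C_mul_le _ _).trans hd.le
  · rw [e, coeff_add, coeff_eq_zero_of_degree_lt hlt, coeff_C_mul]
    have := hm.coeff_natDegree
    rw [hd] at this
    rw [this]
    simp
  · rw [mul_comp, pow_comp]
    refine dvd_mul_of_dvd_right ?_ _
    simp [mul_pow]

end Multiplicity

namespace WeierstrassEquation

/-! ### Multiplicities at points of the special fibre -/

section Points

variable {A K L : Type*} [CommRing A] [Field K] [Field L] [Algebra A L]
  [Algebra K L] {g : ℕ} {E : WeierstrassEquation A K L g} {π : A} {𝔭 : Ideal A}

/-- A lower bound n+1 is the strict bound n < sup, so some H witnesses it, and any lift c may be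
fixed. The exponent (n+2)/2 is (n+1)/2 rounded up. -/
theorem natCast_succ_le_multiplicity_iff [IsDomain A] (hπ : 𝔭 = Ideal.span {π}) (hπ0 : π ≠ 0)
    (p : E.AffinePoint 𝔭) {c : A} (hc : Ideal.Quotient.mk 𝔭 c = p.x) (n : ℕ) :
    ((n + 1 : ℕ) : ℕ∞) ≤ E.multiplicity π p ↔ ∃ H : A[X],
      C (π ^ ((n + 2) / 2)) ∣ (E.Q - 2 * H).comp (C π * X + C c) ∧
        C (π ^ (n + 1)) ∣ (E.P + E.Q * H - H ^ 2).comp (C π * X + C c) := by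
  constructor
  · intro h
    have hlt : (n : ℕ∞) < E.multiplicity π p :=
      lt_of_lt_of_le (by exact_mod_cast Nat.lt_succ_self n) h
    simp only [multiplicity, lt_iSup_iff] at hlt
    obtain ⟨c', hc', H, hH⟩ := hlt
    have hH' : ((n + 1 : ℕ) : ℕ∞) ≤
        lambdaPair π c' (E.Q - 2 * H) (E.P + E.Q * H - H ^ 2) := by
      have := Order.add_one_le_of_lt hH
      exact_mod_cast this
    rw [natCast_le_lambdaPair_iff hπ0] at hH'
    subst hπ
    exact ⟨H, C_dvd_comp_of_mk_eq (hc'.trans hc.symm) hH'.1,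
      C_dvd_comp_of_mk_eq (hc'.trans hc.symm) hH'.2⟩
  · rintro ⟨H, hH⟩
    refine ((natCast_le_lambdaPair_iff hπ0 (n + 1) c _ _).mpr hH).trans ?_
    rw [multiplicity]
    exact le_iSup_of_le c (le_iSup_of_le hc (le_iSup_of_le H le_rfl))

theorem lambdaPair_le_multiplicity (p : E.AffinePoint 𝔭) {c : A}
    (hc : Ideal.Quotient.mk 𝔭 c = p.x) (H : A[X]) :
    lambdaPair π c (E.Q - 2 * H) (E.P + E.Q * H - H ^ 2) ≤ E.multiplicity π p := by
  rw [multiplicity]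
  exact le_iSup_of_le c (le_iSup_of_le hc (le_iSup_of_le H le_rfl))

/-- The point has y-coordinate -H(c), which is y + H(x) = 0 at x = c. -/
theorem exists_affinePoint (hπ : 𝔭 = Ideal.span {π}) {c : A} {H : A[X]}
    (h : C π ∣ (E.P + E.Q * H - H ^ 2).comp (C π * X + C c)) :
    ∃ p : E.AffinePoint 𝔭, Ideal.Quotient.mk 𝔭 c = p.x := by
  rw [C_dvd_iff_dvd_coeff] at h
  have h0 := h 0
  rw [coeff_zero_eq_eval_zero, eval_comp] at h0
  have h1 : Ideal.Quotient.mk 𝔭 (eval c (E.P + E.Q * H - H ^ 2)) = 0 := by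
    rw [Ideal.Quotient.eq_zero_iff_mem, hπ, Ideal.mem_span_singleton]
    simpa using h0
  refine ⟨⟨Ideal.Quotient.mk 𝔭 c, Ideal.Quotient.mk 𝔭 (-H.eval c), ?_⟩, rfl⟩
  rw [eval_map_apply, eval_map_apply]
  simp only [eval_add, eval_sub, eval_mul, eval_pow, map_add, map_sub, map_mul, map_pow] at h1
  rw [map_neg]
  linear_combination -h1

theorem IsDilatation.exists_of_multiplicity_eq {𝔭 : Ideal A} {p : E.AffinePoint 𝔭}
    {E' : WeierstrassEquation A K L g} (h : E.IsDilatation π p E') {n : ℕ}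
    (hp : E.multiplicity π p = n) : ∃ (c : A) (H : A[X]), H.natDegree ≤ g + 1 ∧
      C (π ^ (n / 2)) * E'.Q = (E.Q - 2 * H).comp (C π * X + C c) ∧
      C (π ^ (2 * (n / 2))) * E'.P = (E.P + E.Q * H - H ^ 2).comp (C π * X + C c) ∧
      E.x = algebraMap A L π * E'.x + algebraMap A L c := by
  obtain ⟨c, H, r, -, hH, -, h1, h2, h3, h4, h5, -⟩ := h
  rw [hp] at h1 h2
  norm_cast at h1 h2
  obtain rfl : r = n / 2 := by omega
  exact ⟨c, H, hH, h3, h4, h5⟩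

theorem IsDilatation.pow_mul_Δ {𝔭 : Ideal A} {p : E.AffinePoint 𝔭}
    {E' : WeierstrassEquation A K L g} (h : E.IsDilatation π p E') {n : ℕ}
    (hp : E.multiplicity π p = n) :
    π ^ (n / 2 * (4 * (2 * g + 1))) * E'.Δ = π ^ ((2 * g + 2) * (2 * g + 1)) * E.Δ := by
  obtain ⟨c, H, hH, h3, h4, -⟩ := h.exists_of_multiplicity_eq hp
  rw [mul_comm 2 (n / 2), pow_mul] at h4
  rw [pow_mul]
  exact pow_mul_disc E.natDegree_Q_le E.natDegree_P_le hH E'.natDegree_Q_le E'.natDegree_P_le h3 h4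

end Points

/-! ### Construction of dilatations -/

section Dilatation

variable {A K L : Type*} [CommRing A] [IsDomain A] [Field K] [Algebra A K] [IsFractionRing A K]
  [Field L] [Algebra K L] [Algebra A L] [IsScalarTower A K L] {g : ℕ}
  {E : WeierstrassEquation A K L g} {π : A}

theorem natDegree_le_of_C_mul_eq {n : ℕ} {a : A} (ha : a ≠ 0) {F G : A[X]} {e c : A}
    (h : C a * F = G.comp (C e * X + C c)) (hG : G.natDegree ≤ n) : F.natDegree ≤ n := by
  rw [← natDegree_C_mul ha, h]
  exact (natDegree_comp_linear_le _ _ _).trans hG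

variable (E) in
/-- The Weierstrass equation that results from a change of variables `x = e x' + c`,
`y + H(x) = k y'`. -/
theorem exists_change_of_variables {e k c : A} (he : e ≠ 0) (hk : k ≠ 0) {H : A[X]}
    (hH : H.natDegree ≤ g + 1) (h1 : C k ∣ (E.Q - 2 * H).comp (C e * X + C c))
    (h2 : C (k ^ 2) ∣ (E.P + E.Q * H - H ^ 2).comp (C e * X + C c)) :
    ∃ E' : WeierstrassEquation A K L g,
      C k * E'.Q = (E.Q - 2 * H).comp (C e * X + C c) ∧
      C (k ^ 2) * E'.P = (E.P + E.Q * H - H ^ 2).comp (C e * X + C c) ∧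
      E.x = algebraMap A L e * E'.x + algebraMap A L c ∧
      E.y + aeval E.x H = algebraMap A L k * E'.y := by
  obtain ⟨Q', hQ'⟩ := h1
  obtain ⟨P', hP'⟩ := h2
  have hinj : Function.Injective (algebraMap A L) := by
    rw [IsScalarTower.algebraMap_eq A K L]
    exact (algebraMap K L).injective.comp (IsFractionRing.injective A K)
  have heL : algebraMap A L e ≠ 0 := (map_ne_zero_iff _ hinj).mpr he
  have hkL : algebraMap A L k ≠ 0 := (map_ne_zero_iff _ hinj).mpr hk
  have hk2 : k ^ 2 ≠ 0 := pow_ne_zero 2 hk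
  have hdQ := natDegree_le_of_C_mul_eq hk hQ'.symm
    (natDegree_sub_two_mul_le E.natDegree_Q_le hH)
  have hdP := natDegree_le_of_C_mul_eq hk2 hP'.symm
    (natDegree_add_mul_sub_sq_le (n := g + 1) E.natDegree_Q_le E.natDegree_P_le hH)
  set x' := (E.x - algebraMap A L c) / algebraMap A L e with hx'
  set y' := (E.y + aeval E.x H) / algebraMap A L k with hy'
  have hx : E.x = algebraMap A L e * x' + algebraMap A L c := by
    rw [hx']; field_simp; ring
  have hy : E.y + aeval E.x H = algebraMap A L k * y' := by
    rw [hy']; field_simp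
  have hcomp : ∀ F : A[X], aeval x' (F.comp (C e * X + C c)) = aeval E.x F := by
    intro F
    rw [aeval_comp]
    simp [← hx]
  refine ⟨⟨Q', P', x', y', hdQ, hdP, ?_, ?_, ?_, ?_⟩, hQ'.symm, hP'.symm, hx, hy⟩
  · intro h0
    have := pow_mul_disc E.natDegree_Q_le E.natDegree_P_le hH hdQ hdP hQ'.symm hP'.symm
    rw [h0, mul_zero] at this
    exact mul_ne_zero (pow_ne_zero _ he) E.disc_ne_zero this.symm
  · intro halg
    refine E.transcendental_x ?_
    rw [hx, IsScalarTower.algebraMap_apply A K L, IsScalarTower.algebraMap_apply A K L]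
    exact ((isAlgebraic_algebraMap _).mul halg).add (isAlgebraic_algebraMap _)
  · refine mul_left_cancel₀ (pow_ne_zero 2 hkL) ?_
    have e1 := congrArg (aeval x') hQ'
    have e2 := congrArg (aeval x') hP'
    rw [hcomp] at e1 e2
    simp only [map_add, map_sub, map_mul, map_pow, map_ofNat, aeval_C] at e1 e2
    rw [← e2]
    calc algebraMap A L k ^ 2 * (y' ^ 2 + aeval x' Q' * y')
        = (algebraMap A L k * y') ^ 2 +
            (algebraMap A L k * aeval x' Q') * (algebraMap A L k * y') := by ring
      _ = _ := by
        rw [← hy, ← e1]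
        linear_combination E.equation
  · rw [eq_top_iff, ← E.adjoin_eq_top, IntermediateField.adjoin_le_iff]
    set F := IntermediateField.adjoin K {x', y'}
    have hA : ∀ a : A, algebraMap A L a ∈ F := by
      intro a
      rw [IsScalarTower.algebraMap_apply A K L]
      exact F.algebraMap_mem _
    have hxF : E.x ∈ F := by
      rw [hx]
      exact F.add_mem (F.mul_mem (hA _) (IntermediateField.subset_adjoin _ _ (by simp))) (hA _)
    have hHF : aeval E.x H ∈ F := by
      rw [aeval_eq_sum_range]
      refine sum_mem fun i _ => ?_
      rw [Algebra.smul_def]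
      exact F.mul_mem (hA _) (pow_mem hxF _)
    have hyF : E.y ∈ F := by
      rw [eq_sub_of_add_eq hy]
      exact F.sub_mem (F.mul_mem (hA _) (IntermediateField.subset_adjoin _ _ (by simp))) hHF
    rintro z (rfl | rfl)
    · exact hxF
    · exact hyF

/-- The dilatation at a point whose multiplicity is attained at `c` and `H`. -/
theorem exists_isDilatation {𝔭 : Ideal A} (hπ0 : π ≠ 0)
    (p : E.AffinePoint 𝔭) {c : A} (hc : Ideal.Quotient.mk 𝔭 c = p.x) {H : A[X]}
    (hH : H.natDegree ≤ g + 1) {n : ℕ} (hp : E.multiplicity π p = n)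
    (h : (n : ℕ∞) ≤ lambdaPair π c (E.Q - 2 * H) (E.P + E.Q * H - H ^ 2)) :
    ∃ E' : WeierstrassEquation A K L g, E.IsDilatation π p E' ∧
      C (π ^ (n / 2)) * E'.Q = (E.Q - 2 * H).comp (C π * X + C c) ∧
      C (π ^ (2 * (n / 2))) * E'.P = (E.P + E.Q * H - H ^ 2).comp (C π * X + C c) ∧
      E.x = algebraMap A L π * E'.x + algebraMap A L c := by
  obtain ⟨h1, h2⟩ := (natCast_le_lambdaPair_iff hπ0 n c _ _).mp h
  have hsq : 2 * (n / 2) = (n / 2) * 2 := mul_comm _ _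
  obtain ⟨E', e1, e2, e3, e4⟩ := E.exists_change_of_variables hπ0 (pow_ne_zero (n / 2) hπ0) hH
    ((_root_.map_dvd C (pow_dvd_pow π (by omega))).trans h1)
    ((_root_.map_dvd C (by rw [← pow_mul]; exact pow_dvd_pow π (by omega))).trans h2)
  rw [← pow_mul, ← hsq] at e2
  refine ⟨E', ⟨c, H, n / 2, hc, hH, ?_, ?_, ?_, e1, e2, e3, e4⟩, e1, e2, e3⟩
  · exact le_antisymm (lambdaPair_le_multiplicity p hc H) (hp ▸ h)
  · rw [hp]
    norm_cast
    omega
  · rw [hp]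
    norm_cast
    omega

end Dilatation

/-! ### The discriminant of a double dilatation -/

section Discriminant

variable {A K L : Type*} [CommRing A] [IsDomain A] [Field K]
  [Field L] [Algebra K L] [Algebra A L] {g : ℕ} {E : WeierstrassEquation A K L g}

/-- The two substitutions x = πx' + c contribute (2g+2)(2g+1) each, and the divisions of y by π^g
and π^(g+1) remove 4(2g+1)(2g+1) in total; the balance is -4g(2g+1). -/
theorem Δ_of_isDilatation {𝔭 : Ideal A} {π : A} (hπ0 : π ≠ 0)
    {p₀ : E.AffinePoint 𝔭} {E₁ E₂ : WeierstrassEquation A K L g}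
    {q₀ : E₁.AffinePoint 𝔭} (hp₀ : E.multiplicity π p₀ = ((2 * g + 1 : ℕ) : ℕ∞))
    (hE₁ : E.IsDilatation π p₀ E₁) (hq₀ : E₁.multiplicity π q₀ = ((2 * g + 2 : ℕ) : ℕ∞))
    (hE₂ : E₁.IsDilatation π q₀ E₂) : E.Δ = π ^ (4 * g * (2 * g + 1)) * E₂.Δ := by
  have h1 := hE₁.pow_mul_Δ hp₀
  have h2 := hE₂.pow_mul_Δ hq₀
  rw [show (2 * g + 1) / 2 = g by omega] at h1
  rw [show (2 * g + 2) / 2 = g + 1 by omega] at h2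
  refine mul_left_cancel₀ (pow_ne_zero (2 * ((2 * g + 2) * (2 * g + 1))) hπ0) ?_
  have h3 : π ^ (g * (4 * (2 * g + 1)) + (g + 1) * (4 * (2 * g + 1))) =
      π ^ (2 * ((2 * g + 2) * (2 * g + 1))) * π ^ (4 * g * (2 * g + 1)) := by
    rw [← pow_add]; ring_nf
  rw [pow_add] at h3
  linear_combination E₂.Δ * h3 - π ^ (g * (4 * (2 * g + 1))) * h2 -
    π ^ ((2 * g + 2) * (2 * g + 1)) * h1

theorem emultiplicity_add_of_isDilatation {𝔭 : Ideal A} {π : A} (hπ : Prime π)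
    {p₀ : E.AffinePoint 𝔭} {E₁ E₂ : WeierstrassEquation A K L g}
    {q₀ : E₁.AffinePoint 𝔭} (hp₀ : E.multiplicity π p₀ = ((2 * g + 1 : ℕ) : ℕ∞))
    (hE₁ : E.IsDilatation π p₀ E₁) (hq₀ : E₁.multiplicity π q₀ = ((2 * g + 2 : ℕ) : ℕ∞))
    (hE₂ : E₁.IsDilatation π q₀ E₂) :
    emultiplicity π E₂.Δ + (4 * g * (2 * g + 1) : ℕ) = emultiplicity π E.Δ := by
  rw [Δ_of_isDilatation hπ.ne_zero hp₀ hE₁ hq₀ hE₂, emultiplicity_mul hπ,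
    emultiplicity_pow_self hπ.ne_zero hπ.not_isUnit, add_comm]

end Discriminant

/-! ### Pointedness of double dilatations and existence of the two points -/

section Pointed

/-- The composite of two changes of variables. -/
theorem change_trans {K : Type*} [Field K] {Q P H Q₁ P₁ H₁ Q₂ P₂ : K[X]} {k e c k' e' c' : K}
    (he : e ≠ 0) (h1 : C k * Q₁ = (Q - 2 * H).comp (C e * X + C c))
    (h2 : C (k ^ 2) * P₁ = (P + Q * H - H ^ 2).comp (C e * X + C c))
    (h3 : C k' * Q₂ = (Q₁ - 2 * H₁).comp (C e' * X + C c'))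
    (h4 : C (k' ^ 2) * P₂ = (P₁ + Q₁ * H₁ - H₁ ^ 2).comp (C e' * X + C c')) :
    C (k * k') * Q₂ = (Q - 2 * (H + C k * H₁.comp (C e⁻¹ * X + C (-(e⁻¹ * c))))).comp
      (C (e * e') * X + C (e * c' + c)) ∧
    C ((k * k') ^ 2) * P₂ = (P + Q * (H + C k * H₁.comp (C e⁻¹ * X + C (-(e⁻¹ * c)))) -
      (H + C k * H₁.comp (C e⁻¹ * X + C (-(e⁻¹ * c)))) ^ 2).comp
        (C (e * e') * X + C (e * c' + c)) := by
  have hlin : (C (e * e') * X + C (e * c' + c) : K[X]) =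
      (C e * X + C c).comp (C e' * X + C c') := by
    simp only [add_comp, mul_comp, C_comp, X_comp, C_mul, C_add]
    ring
  have hinv : (C e⁻¹ * X + C (-(e⁻¹ * c)) : K[X]).comp (C e * X + C c) = X := by
    have : (C e⁻¹ * C e : K[X]) = 1 := by rw [← C_mul, inv_mul_cancel₀ he, C_1]
    simp only [add_comp, mul_comp, C_comp, X_comp, C_mul, C_neg, neg_comp]
    linear_combination X * this
  have hδ : (C k * H₁.comp (C e⁻¹ * X + C (-(e⁻¹ * c)))).comp (C e * X + C c) = C k * H₁ := by
    rw [mul_comp, C_comp, comp_assoc, hinv, comp_X]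
  rw [hlin, ← comp_assoc, ← comp_assoc, (shift_comp Q P H _ _).1, (shift_comp Q P H _ _).2, hδ,
    ← h1, ← h2]
  constructor
  · rw [show C k * Q₁ - 2 * (C k * H₁) = C k * (Q₁ - 2 * H₁) by ring, mul_comp, C_comp, ← h3, C_mul]
    ring
  · rw [show C (k ^ 2) * P₁ + C k * Q₁ * (C k * H₁) - (C k * H₁) ^ 2 =
      C (k ^ 2) * (P₁ + Q₁ * H₁ - H₁ ^ 2) by rw [C_pow]; ring, mul_comp, C_comp, ← h4, mul_pow,
      C_mul]
    ring

variable {A K L : Type*} [CommRing A] [IsDomain A] [Field K] [Algebra A K] [IsFractionRing A K]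
  [Field L] [Algebra K L] [Algebra A L] {g : ℕ}
  {E : WeierstrassEquation A K L g} {w₀ : ValuationSubring L}

/-- An equation obtained from a pointed one by two changes of variables is pointed if the second
one cancels the term of degree `g + 1` in the first one. -/
theorem IsPointed.of_change_trans (hE : E.IsPointed w₀) {E₁ E₂ : WeierstrassEquation A K L g}
    (hw : ∀ a : A, algebraMap A L a ∈ w₀) {e k c e' k' c' : A} {H H₁ : A[X]}
    (he : e ≠ 0) (hk : k ≠ 0) (hk' : k' ≠ 0) (hH : H.natDegree ≤ g + 1)
    (hH₁ : H₁.natDegree ≤ g + 1)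
    (h1 : C k * E₁.Q = (E.Q - 2 * H).comp (C e * X + C c))
    (h2 : C (k ^ 2) * E₁.P = (E.P + E.Q * H - H ^ 2).comp (C e * X + C c))
    (hx : E.x = algebraMap A L e * E₁.x + algebraMap A L c)
    (h3 : C k' * E₂.Q = (E₁.Q - 2 * H₁).comp (C e' * X + C c'))
    (h4 : C (k' ^ 2) * E₂.P = (E₁.P + E₁.Q * H₁ - H₁ ^ 2).comp (C e' * X + C c'))
    (hx₁ : E₁.x = algebraMap A L e' * E₂.x + algebraMap A L c')
    (hcancel : e ^ (g + 1) * H.coeff (g + 1) + k * H₁.coeff (g + 1) = 0)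
    (hlead : (k * k') ^ 2 = (e * e') ^ (2 * g + 1)) : E₂.IsPointed w₀ := by
  set φ := algebraMap A K with hφ
  have hinj : Function.Injective φ := IsFractionRing.injective A K
  have hφe : φ e ≠ 0 := (map_ne_zero_iff _ hinj).mpr he
  have hφk : φ (k * k') ≠ 0 := (map_ne_zero_iff _ hinj).mpr (mul_ne_zero hk hk')
  have m1 := congrArg (Polynomial.map φ) h1
  have m2 := congrArg (Polynomial.map φ) h2
  have m3 := congrArg (Polynomial.map φ) h3
  have m4 := congrArg (Polynomial.map φ) h4
  simp only [map_comp_linear, Polynomial.map_mul, Polynomial.map_sub, Polynomial.map_add,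
    Polynomial.map_pow, map_C, Polynomial.map_ofNat, map_pow φ] at m1 m2 m3 m4
  obtain ⟨e1, e2⟩ := change_trans hφe m1 m2 m3 m4
  set G := H.map φ + C (φ k) * (H₁.map φ).comp (C (φ e)⁻¹ * X + C (-((φ e)⁻¹ * φ c))) with hG
  have hGd : G.natDegree ≤ g + 1 := by
    refine natDegree_add_le_of_degree_le (natDegree_map_le.trans hH) ?_
    refine (natDegree_C_mul_le _ _).trans ((natDegree_comp_linear_le _ _ _).trans ?_)
    exact natDegree_map_le.trans hH₁
  -- The coefficient is H_(g+1) + k e^(-(g+1)) (H₁)_(g+1), a multiple of the expression that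
  -- `hcancel` makes zero. So the composite shift has degree at most g and preserves the pointed
  -- shape.
  have hGc : G.coeff (g + 1) = 0 := by
    rw [hG, coeff_add, coeff_C_mul, coeff_comp_linear (natDegree_map_le.trans hH₁), coeff_map,
      coeff_map, inv_pow]
    have := congrArg φ hcancel
    rw [map_add, map_mul, map_mul, map_pow, map_zero] at this
    have he' := pow_ne_zero (g + 1) hφe
    field_simp
    linear_combination this
  have hGg : G.natDegree ≤ g := by
    rw [natDegree_le_iff_coeff_eq_zero]
    intro N hN
    rcases Nat.lt_or_ge (g + 1) N with h | h
    · exact coeff_eq_zero_of_natDegree_lt (by omega)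
    · rwa [show N = g + 1 by omega]
  obtain ⟨hm, hd⟩ := natDegree_eq_of_monic (natDegree_map_le.trans hE.natDegree_Q_le)
    (hE.monic_P.map φ) (by rw [hE.monic_P.natDegree_map, hE.natDegree_P]) hGg
  have hlead' : (φ k * φ k') ^ 2 = (φ e * φ e') ^ (2 * g + 1) := by
    rw [← map_mul, ← map_mul, ← map_pow, ← map_pow, hlead]
  rw [map_mul] at hφk
  have hdP : E₂.P.natDegree ≤ 2 * g + 1 := by
    rw [← natDegree_map_eq_of_injective hinj, ← natDegree_C_mul (pow_ne_zero 2 hφk), e2]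
    exact (natDegree_comp_linear_le _ _ _).trans hd.le
  have hcP : E₂.P.coeff (2 * g + 1) = 1 := by
    apply hinj
    have := congrArg (coeff · (2 * g + 1)) e2
    simp only [coeff_comp_linear hd.le, coeff_C_mul, coeff_map] at this
    have h1 := hm.coeff_natDegree
    rw [hd] at h1
    rw [h1, ← hlead'] at this
    rw [map_one]
    exact mul_left_cancel₀ (pow_ne_zero 2 hφk) this
  refine ⟨?_, monic_of_natDegree_le_of_coeff_eq_one _ hdP hcP,
    le_antisymm hdP (le_natDegree_of_ne_zero (by rw [hcP]; exact one_ne_zero)), fun hmem => ?_⟩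
  · rw [← natDegree_map_eq_of_injective hinj, ← natDegree_C_mul hφk, e1]
    exact (natDegree_comp_linear_le _ _ _).trans
      (natDegree_sub_two_mul_le (natDegree_map_le.trans hE.natDegree_Q_le) hGg)
  · refine hE.pole ?_
    rw [hx, hx₁]
    exact add_mem (mul_mem (hw _) (add_mem (mul_mem (hw _) hmem) (hw _))) (hw _)

variable [IsScalarTower A K L]

/-- The double dilatation of a pointed equation can be given by a pointed equation. -/
theorem IsPointed.exists_isDilatation (hE : E.IsPointed w₀)
    (hw : ∀ a : A, algebraMap A L a ∈ w₀) {𝔭 : Ideal A} {π : A} (hπ : 𝔭 = Ideal.span {π})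
    (hπ0 : π ≠ 0) {p₀ : E.AffinePoint 𝔭} {E₁ : WeierstrassEquation A K L g}
    {q₀ : E₁.AffinePoint 𝔭} (hp₀ : E.multiplicity π p₀ = ((2 * g + 1 : ℕ) : ℕ∞))
    (hE₁ : E.IsDilatation π p₀ E₁) (hq₀ : E₁.multiplicity π q₀ = ((2 * g + 2 : ℕ) : ℕ∞)) :
    ∃ E₂ : WeierstrassEquation A K L g, E₁.IsDilatation π q₀ E₂ ∧ E₂.IsPointed w₀ := by
  obtain ⟨c, H, hH, h1, h2, hx⟩ := hE₁.exists_of_multiplicity_eq hp₀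
  obtain ⟨c', hc'⟩ := Ideal.Quotient.mk_surjective q₀.x
  obtain ⟨H', h5, h6⟩ := (natCast_succ_le_multiplicity_iff hπ hπ0 q₀ hc' (2 * g + 1)).mp hq₀.ge
  -- For e = π and k = π^g the cancellation condition reads (H₁)_(g+1) = -π H_(g+1). Changing H' by
  -- δ is harmless, since δ has multiplicity at least g+1, half of 2g+2.
  obtain ⟨δ, hδd, hδc, hδ⟩ := exists_natDegree_le_C_dvd (π := π) c'
    (-(π * H.coeff (g + 1))) (g + 1) H'
  rw [show (2 * g + 1 + 2) / 2 = g + 1 by omega] at h5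
  rw [show 2 * g + 1 + 1 = 2 * (g + 1) by ring] at h6
  obtain ⟨h7, h8⟩ := C_dvd_shift h5 h6 hδ
  obtain ⟨E₂, hdil, h3, h4, hx₁⟩ := WeierstrassEquation.exists_isDilatation hπ0 q₀ hc' hδd hq₀ (by
    rw [natCast_le_lambdaPair_iff hπ0, show (2 * g + 2 + 1) / 2 = g + 1 by omega]
    exact ⟨h7, h8⟩)
  rw [show (2 * g + 1) / 2 = g by omega] at h1 h2
  rw [show (2 * g + 2) / 2 = g + 1 by omega] at h3 h4
  rw [mul_comm 2, pow_mul] at h2 h4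
  refine ⟨E₂, hdil, hE.of_change_trans hw hπ0 (pow_ne_zero g hπ0) (pow_ne_zero (g + 1) hπ0) hH
    hδd h1 h2 hx h3 h4 hx₁ ?_ ?_⟩
  · rw [hδc]
    ring
  · ring

/-- If the change of variables `x = π² x' + c`, `y + H(x) = π^{2g+1} y'` leads to an integral
pointed equation, then there are points of multiplicities `2g + 1` and `2g + 2`. -/
theorem IsPointed.exists_points (hE : E.IsPointed w₀) {𝔭 : Ideal A} {π : A}
    (hπ : 𝔭 = Ideal.span {π}) (hp : Prime π) {c : A} {H : A[X]} (hH : H.natDegree ≤ g)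
    (h1 : C (π ^ (2 * g + 1)) ∣ (E.Q - 2 * H).comp (C (π ^ 2) * X + C c))
    (h2 : C (π ^ (4 * g + 2)) ∣ (E.P + E.Q * H - H ^ 2).comp (C (π ^ 2) * X + C c)) :
    ∃ p₀ : E.AffinePoint 𝔭, E.multiplicity π p₀ = ((2 * g + 1 : ℕ) : ℕ∞) ∧
      ∃ E₁ : WeierstrassEquation A K L g, E.IsDilatation π p₀ E₁ ∧
        ∃ q₀ : E₁.AffinePoint 𝔭, E₁.multiplicity π q₀ = ((2 * g + 2 : ℕ) : ℕ∞) := by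
  have hπ0 := hp.ne_zero
  obtain ⟨hm, hd⟩ := natDegree_eq_of_monic hE.natDegree_Q_le hE.monic_P hE.natDegree_P hH
  have hcP := hm.coeff_natDegree
  rw [hd] at hcP
  have d1 := C_pow_sub_dvd_comp hπ0 (m := g) (by omega)
    (natDegree_sub_two_mul_le hE.natDegree_Q_le hH) h1
  have d2 := C_pow_sub_dvd_comp hπ0 (m := 2 * g + 1) (by omega) hd.le h2
  rw [show 2 * g + 1 - g = g + 1 by omega] at d1
  rw [show 4 * g + 2 - (2 * g + 1) = 2 * g + 1 by omega] at d2
  obtain ⟨p₀, hc⟩ := exists_affinePoint (E := E) (H := H) hπ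
    ((_root_.map_dvd C (dvd_pow_self π (by omega))).trans d2)
  have hp₀ : E.multiplicity π p₀ = ((2 * g + 1 : ℕ) : ℕ∞) := by
    refine le_antisymm (le_of_not_gt fun hlt => ?_) ?_
    · have h3 : ((2 * g + 1 + 1 : ℕ) : ℕ∞) ≤ E.multiplicity π p₀ := by
        have := Order.add_one_le_of_lt hlt
        exact_mod_cast this
      rw [natCast_succ_le_multiplicity_iff hπ hπ0 p₀ hc] at h3
      obtain ⟨H', -, h3⟩ := h3
      -- A larger multiplicity would already be attained by H, but the coefficient of degree 2g+1
      -- after the substitution is exactly π^(2g+1).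
      have h4 := C_dvd_of_odd_multiplicity hp d1 d2 h3
      rw [C_dvd_iff_dvd_coeff] at h4
      have h5 := h4 (2 * g + 1)
      rw [coeff_comp_linear hd.le] at h5
      rw [hcP, mul_one] at h5
      have := (pow_dvd_pow_iff hπ0 hp.not_isUnit).mp h5
      omega
    · rw [natCast_succ_le_multiplicity_iff hπ hπ0 p₀ hc]
      exact ⟨H, by rwa [show (2 * g + 2) / 2 = g + 1 by omega], d2⟩
  obtain ⟨E₁, hE₁, e1, e2, -⟩ := WeierstrassEquation.exists_isDilatation hπ0 p₀ hc
    (hH.trans (Nat.le_succ g)) hp₀ (by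
      rw [natCast_le_lambdaPair_iff hπ0, show (2 * g + 1 + 1) / 2 = g + 1 by omega]
      exact ⟨d1, d2⟩)
  rw [show (2 * g + 1) / 2 = g by omega] at e1 e2
  -- The centre c is absorbed in the first dilatation, so the second is examined at x₁ = 0 with H =
  -- 0.
  have hlin : (C π * X + C c).comp (C π * X + C 0) = C (π ^ 2) * X + C c := by
    simp [C_pow]
    ring
  have f1 := congrArg (fun p : A[X] => p.comp (C π * X + C 0)) e1
  have f2 := congrArg (fun p : A[X] => p.comp (C π * X + C 0)) e2
  simp only [mul_comp, C_comp, comp_assoc, hlin] at f1 f2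
  rw [← f1, show 2 * g + 1 = g + (g + 1) by ring, pow_add, C_mul,
    mul_dvd_mul_iff_left (C_ne_zero.mpr (pow_ne_zero _ hπ0))] at h1
  obtain ⟨p, hpp⟩ := h2
  -- The quotient p is the right-hand side of the resulting integral equation; the factor
  -- (π²)^(2g+1) in degree 2g+1 makes it monic.
  have hpd : p.natDegree = 2 * g + 1 ∧ p.coeff (2 * g + 1) = 1 := by
    have hdle : p.natDegree ≤ 2 * g + 1 :=
      natDegree_le_of_C_mul_eq (pow_ne_zero _ hπ0) hpp.symm hd.le
    have hc1 : p.coeff (2 * g + 1) = 1 := by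
      have := congrArg (coeff · (2 * g + 1)) hpp
      simp only [coeff_comp_linear hd.le, coeff_C_mul] at this
      rw [hcP, ← pow_mul, show 2 * (2 * g + 1) = 4 * g + 2 by ring] at this
      exact (mul_left_cancel₀ (pow_ne_zero _ hπ0) this).symm
    exact ⟨le_antisymm hdle (le_natDegree_of_ne_zero (by rw [hc1]; exact one_ne_zero)), hc1⟩
  have hpm : p.Monic := monic_of_natDegree_le_of_coeff_eq_one _ hpd.1.le hpd.2
  rw [← f2, show 4 * g + 2 = 2 * g + (2 * g + 2) by ring, pow_add, C_mul, mul_assoc] at hpp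
  have hpp' := mul_left_cancel₀ (C_ne_zero.mpr (pow_ne_zero _ hπ0)) hpp
  have g1 : C (π ^ (g + 1)) ∣ (E₁.Q - 2 * 0).comp (C π * X + C 0) := by
    rwa [mul_zero, sub_zero]
  have g2 : (E₁.P + E₁.Q * 0 - 0 ^ 2).comp (C π * X + C 0) = C (π ^ (2 * g + 2)) * p := by
    rw [← hpp']
    simp
  obtain ⟨q₀, hq⟩ := exists_affinePoint (E := E₁) (H := 0) (c := 0) hπ
    (by rw [g2]; exact (_root_.map_dvd C (dvd_pow_self π (by omega))).mul_right _)
  refine ⟨p₀, hp₀, E₁, hE₁, q₀, le_antisymm (le_of_not_gt fun hlt => ?_) ?_⟩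
  · have h3 : ((2 * g + 2 + 1 : ℕ) : ℕ∞) ≤ E₁.multiplicity π q₀ := by
      have := Order.add_one_le_of_lt hlt
      exact_mod_cast this
    rw [natCast_succ_le_multiplicity_iff hπ hπ0 q₀ hq,
      show (2 * g + 2 + 2) / 2 = g + 2 by omega] at h3
    obtain ⟨H', h3, h4⟩ := h3
    exact not_C_dvd_of_monic hp hpm (by rw [hpd.1]; exact ⟨g, rfl⟩) g1 g2 h3 h4
  · rw [natCast_succ_le_multiplicity_iff hπ hπ0 q₀ hq]
    exact ⟨0, by rwa [show (2 * g + 1 + 2) / 2 = g + 1 by omega], by rw [g2]; exact dvd_mul_right _ _⟩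

end Pointed

/-! ### Base change of Weierstrass equations -/

section BaseChange

variable {R S K L : Type*} [CommRing R] [CommRing S] [Algebra R S] [Field K] [Field L]
  [Algebra R L] [Algebra S L] [Algebra K L] [IsScalarTower R S L] {g : ℕ}

/-- The equation regarded as one over a larger ring. -/
noncomputable def baseChange (S : Type*) [CommRing S] [Algebra R S] [Algebra S L] [IsScalarTower R S L]
    (h : Function.Injective (algebraMap R S)) (E : WeierstrassEquation R K L g) :
    WeierstrassEquation S K L g where
  Q := E.Q.map (algebraMap R S)
  P := E.P.map (algebraMap R S)
  x := E.x
  y := E.y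
  natDegree_Q_le := natDegree_map_le.trans E.natDegree_Q_le
  natDegree_P_le := natDegree_map_le.trans E.natDegree_P_le
  disc_ne_zero := by
    rw [← map_disc]
    exact (map_ne_zero_iff _ h).mpr E.disc_ne_zero
  transcendental_x := E.transcendental_x
  equation := by
    rw [aeval_map_algebraMap, aeval_map_algebraMap]
    exact E.equation
  adjoin_eq_top := E.adjoin_eq_top

theorem Δ_baseChange (h : Function.Injective (algebraMap R S)) (E : WeierstrassEquation R K L g) :
    (E.baseChange S h).Δ = algebraMap R S E.Δ :=
  (map_disc _ _ _ _).symm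

theorem IsPointed.baseChange [Nontrivial S] {E : WeierstrassEquation R K L g}
    {w₀ : ValuationSubring L} (hE : E.IsPointed w₀) (h : Function.Injective (algebraMap R S)) :
    (E.baseChange S h).IsPointed w₀ where
  natDegree_Q_le := natDegree_map_le.trans hE.natDegree_Q_le
  monic_P := hE.monic_P.map _
  natDegree_P := (hE.monic_P.natDegree_map _).trans hE.natDegree_P
  pole := hE.pole

end BaseChange

/-! ### Failure of minimality -/

section Minimality

theorem dvd_of_not_isUnit {A O : Type*} [CommRing A] {𝔭 : Ideal A} [𝔭.IsMaximal] {π : A}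
    [CommRing O] [Algebra A O] [IsLocalization.AtPrime O 𝔭] (hπ : 𝔭 = Ideal.span {π}) {o : O}
    (ho : ¬ IsUnit o) : algebraMap A O π ∣ o := by
  obtain ⟨a, s, rfl⟩ := IsLocalization.exists_mk'_eq 𝔭.primeCompl o
  rw [IsLocalization.AtPrime.isUnit_mk'_iff O 𝔭] at ho
  have ha : a ∈ 𝔭 := not_not.mp ho
  rw [hπ, Ideal.mem_span_singleton] at ha
  obtain ⟨t, rfl⟩ := ha
  exact ⟨IsLocalization.mk' O t s, by rw [IsLocalization.mul_mk'_eq_mk'_of_mul]⟩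

variable {A O K L : Type*} [CommRing A] [IsDomain A] [Field K]
  [Field L] [Algebra K L] [Algebra A L] {g : ℕ}
  {E : WeierstrassEquation A K L g} {w₀ : ValuationSubring L}
  {𝔭 : Ideal A} [𝔭.IsMaximal] {π : A}
  [CommRing O] [Algebra A O] [IsLocalization.AtPrime O 𝔭] [Algebra O L]

/-- A pointed equation that is not minimal becomes integral after a change of variables
`x = π² x' + c`, `y + H(x) = π^{2g+1} y'`. -/
theorem IsPointed.exists_C_dvd [Algebra A K] [IsFractionRing A K] [IsScalarTower A K L] [IsDomain O]
    [ValuationRing O] [Algebra O K] [IsFractionRing O K] [IsScalarTower A O K]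
    [IsScalarTower O K L] (hg : 1 ≤ g)
    (hw : ∀ a : K, algebraMap K L a ∈ w₀)
    (hE : E.IsPointed w₀) (hπ : 𝔭 = Ideal.span {π}) (hπ0 : π ≠ 0)
    {E' : WeierstrassEquation O K L g} (hE' : E'.IsPointed w₀)
    (hlt : emultiplicity (algebraMap A O π) E'.Δ < emultiplicity π E.Δ) :
    ∃ (c : A) (H : A[X]), H.natDegree ≤ g ∧
      C (π ^ (2 * g + 1)) ∣ (E.Q - 2 * H).comp (C (π ^ 2) * X + C c) ∧
      C (π ^ (4 * g + 2)) ∣ (E.P + E.Q * H - H ^ 2).comp (C (π ^ 2) * X + C c) := by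
  have hAK := IsFractionRing.injective A K
  have hOK := IsFractionRing.injective O K
  obtain ⟨u, b, H, hu, hH, h1, h2⟩ :=
    (hE.baseChange (S := K) hAK).exists_change hg hw (hE'.baseChange (S := K) hOK)
  have hΔ : algebraMap A K E.Δ = u ^ (4 * g * (2 * g + 1)) * algebraMap O K E'.Δ := by
    rw [← Δ_baseChange hAK, ← Δ_baseChange hOK]
    rw [show 4 * g + 2 = (2 * g + 1) * 2 by ring, pow_mul] at h2
    have := pow_mul_disc (E.baseChange K hAK).natDegree_Q_le (E.baseChange K hAK).natDegree_P_le
      (hH.trans (Nat.le_succ g)) (E'.baseChange K hOK).natDegree_Q_le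
      (E'.baseChange K hOK).natDegree_P_le h1 h2
    refine mul_left_cancel₀ (pow_ne_zero ((2 * g + 2) * (2 * g + 1)) (pow_ne_zero 2 hu)) ?_
    refine this.symm.trans ?_
    rw [← mul_assoc]
    congr 1
    rw [← pow_mul, ← pow_mul, ← pow_add]
    congr 1
    ring
  -- If u⁻¹ were integral, Δ' would be a multiple of Δ, against the strict inequality. So u is a
  -- non-unit of O, hence divisible by π.
  have hinv : ¬ ∃ w : O, algebraMap O K w = u⁻¹ := by
    rintro ⟨w, hw'⟩
    refine absurd hlt (not_lt.mpr ?_)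
    have h3 : w ^ (4 * g * (2 * g + 1)) * algebraMap A O E.Δ = E'.Δ := by
      apply hOK
      rw [map_mul, map_pow, hw', ← IsScalarTower.algebraMap_apply A O K, hΔ, inv_pow,
        inv_mul_cancel_left₀ (pow_ne_zero _ hu)]
    refine le_trans ?_ (emultiplicity_le_emultiplicity_of_dvd_right (Dvd.intro_left _ h3))
    refine emultiplicity_le_emultiplicity_iff.mpr fun n hn => ?_
    rw [← map_pow]
    exact _root_.map_dvd _ hn
  obtain ⟨v, rfl⟩ := (ValuationRing.isInteger_or_isInteger O u).resolve_right hinv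
  have hv : algebraMap A O π ∣ v := by
    refine dvd_of_not_isUnit hπ fun hv => hinv ?_
    obtain ⟨v, rfl⟩ := hv
    refine ⟨(v⁻¹ : Oˣ), eq_inv_of_mul_eq_one_left ?_⟩
    rw [← map_mul]
    simp
  have hmap : ∀ F : A[X], F.map (algebraMap A K) = (F.map (algebraMap A O)).map (algebraMap O K) := by
    intro F
    rw [Polynomial.map_map, ← IsScalarTower.algebraMap_eq]
  have hAO : Function.Injective (algebraMap A O) := by
    rw [IsScalarTower.algebraMap_eq A O K] at hAK
    exact Function.Injective.of_comp hAK
  change C _ * E'.Q.map (algebraMap O K) =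
    (E.Q.map (algebraMap A K) - 2 * H).comp _ at h1
  change C _ * E'.P.map (algebraMap O K) =
    (E.P.map (algebraMap A K) + E.Q.map (algebraMap A K) * H - H ^ 2).comp _ at h2
  rw [hmap] at h1 h2
  rw [hmap] at h2
  obtain ⟨b', H', hH', h3, h4⟩ := exists_integral_change hg
    (natDegree_map_le.trans hE.natDegree_Q_le) hE'.natDegree_Q_le (hE.monic_P.map _)
    ((hE.monic_P.natDegree_map _).trans hE.natDegree_P) hE'.monic_P hE'.natDegree_P
    (fun h => hu (by rw [h, map_zero])) hv hH h1 h2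
  exact exists_approximation (O := O) hπ hπ0 hH' h3 h4

theorem emultiplicity_baseChange_lt [IsPrincipalIdealRing A] [IsScalarTower A O L] (hg : 1 ≤ g)
    (hπ : 𝔭 = Ideal.span {π}) (hπ0 : π ≠ 0) {E₂ : WeierstrassEquation A K L g}
    (h : emultiplicity π E₂.Δ + (4 * g * (2 * g + 1) : ℕ) = emultiplicity π E.Δ)
    (hAO : Function.Injective (algebraMap A O)) :
    emultiplicity (algebraMap A O π) (E₂.baseChange O hAO).Δ < emultiplicity π E.Δ := by
  have hle : emultiplicity (algebraMap A O π) (E₂.baseChange O hAO).Δ ≤ emultiplicity π E₂.Δ := by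
    rw [Δ_baseChange]
    exact emultiplicity_le_emultiplicity_iff.mpr fun n hn => pow_dvd_of_algebraMap_dvd hπ hπ0 hn
  refine hle.trans_lt ?_
  -- Finiteness of v(Δ) is needed: adding a positive number to ∞ would give no strict inequality.
  have hfin : FiniteMultiplicity π E₂.Δ :=
    FiniteMultiplicity.of_not_isUnit (prime_generator hπ hπ0).not_isUnit E₂.disc_ne_zero
  rw [← h, hfin.emultiplicity_eq_multiplicity]
  have : 0 < 4 * g * (2 * g + 1) := by positivity
  exact_mod_cast Nat.lt_add_of_pos_right this

end Minimality

end WeierstrassEquation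

end Hyperelliptic

/-! ### Non-minimality and double dilatations -/

theorem mainTheorem2 {A K L : Type*} [CommRing A] [IsDomain A] [IsPrincipalIdealRing A]
    [Field K] [Algebra A K] [IsFractionRing A K]
    [Field L] [Algebra K L] [Algebra A L] [IsScalarTower A K L]
    (𝔭 : Ideal A) [𝔭.IsMaximal] (π : A) (hπ : 𝔭 = Ideal.span {π}) (hπ0 : π ≠ 0)
    (hk : letI := Ideal.Quotient.field 𝔭; PerfectField (A ⧸ 𝔭))
    (g : ℕ) (hg : 1 ≤ g)
    (w₀ : ValuationSubring L) (hw₀ : Hyperelliptic.IsRationalPoint K w₀)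
    (E : Hyperelliptic.WeierstrassEquation A K L g) (hE : E.IsPointed w₀) :
    (¬ E.IsPointedMinimalAt w₀ 𝔭 π ↔
      ∃ p₀ : E.AffinePoint 𝔭, E.multiplicity π p₀ = 2 * g + 1 ∧
        ∃ E₁ : Hyperelliptic.WeierstrassEquation A K L g, E.IsDilatation π p₀ E₁ ∧
          ∃ q₀ : E₁.AffinePoint 𝔭, E₁.multiplicity π q₀ = 2 * g + 2) ∧
    ∀ (p₀ : E.AffinePoint 𝔭) (E₁ : Hyperelliptic.WeierstrassEquation A K L g)
      (q₀ : E₁.AffinePoint 𝔭),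
      E.multiplicity π p₀ = 2 * g + 1 → E.IsDilatation π p₀ E₁ →
      E₁.multiplicity π q₀ = 2 * g + 2 →
        (∃ E₂ : Hyperelliptic.WeierstrassEquation A K L g,
          E₁.IsDilatation π q₀ E₂ ∧ E₂.IsPointed w₀) ∧
        ∀ E₂ : Hyperelliptic.WeierstrassEquation A K L g, E₁.IsDilatation π q₀ E₂ →
          emultiplicity π E₂.Δ + (4 * g * (2 * g + 1) : ℕ) = emultiplicity π E.Δ := by
  have hprime := Hyperelliptic.prime_generator hπ hπ0
  have hw := hw₀.algebraMap_mem
  have hwA : ∀ a : A, algebraMap A L a ∈ w₀ := fun a => by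
    rw [IsScalarTower.algebraMap_apply A K L]
    exact hw _
  have e1 : (2 * g + 1 : ℕ∞) = ((2 * g + 1 : ℕ) : ℕ∞) := by push_cast; rfl
  have e2 : (2 * g + 2 : ℕ∞) = ((2 * g + 2 : ℕ) : ℕ∞) := by push_cast; rfl
  rw [e1, e2]
  -- Proved first because it also gives the converse: the pointed `E₂`, viewed over the local ring,
  -- violates minimality.
  have moreover : ∀ (p₀ : E.AffinePoint 𝔭) (E₁ : Hyperelliptic.WeierstrassEquation A K L g)
      (q₀ : E₁.AffinePoint 𝔭), E.multiplicity π p₀ = ((2 * g + 1 : ℕ) : ℕ∞) →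
      E.IsDilatation π p₀ E₁ → E₁.multiplicity π q₀ = ((2 * g + 2 : ℕ) : ℕ∞) →
        (∃ E₂ : Hyperelliptic.WeierstrassEquation A K L g,
          E₁.IsDilatation π q₀ E₂ ∧ E₂.IsPointed w₀) ∧
        ∀ E₂ : Hyperelliptic.WeierstrassEquation A K L g, E₁.IsDilatation π q₀ E₂ →
          emultiplicity π E₂.Δ + (4 * g * (2 * g + 1) : ℕ) = emultiplicity π E.Δ :=
    fun p₀ E₁ q₀ hp hE₁ hq => ⟨hE.exists_isDilatation hwA hπ hπ0 hp hE₁ hq, fun E₂ hE₂ =>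
      Hyperelliptic.WeierstrassEquation.emultiplicity_add_of_isDilatation hprime hp hE₁ hq hE₂⟩
  refine ⟨?_, moreover⟩
  let O := Localization.subalgebra.ofField K 𝔭.primeCompl 𝔭.primeCompl_le_nonZeroDivisors
  have : IsLocalization.AtPrime O 𝔭 :=
    Localization.subalgebra.isLocalization_ofField K 𝔭.primeCompl _
  have hp0 : 𝔭 ≠ ⊥ := by
    rw [hπ, Ne, Ideal.span_singleton_eq_bot]
    exact hπ0
  have : IsDiscreteValuationRing O :=
    IsLocalization.AtPrime.isDiscreteValuationRing_of_dedekind_domain A hp0 O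
  constructor
  · intro hmin
    rw [Hyperelliptic.WeierstrassEquation.IsPointedMinimalAt] at hmin
    push Not at hmin
    obtain ⟨E', hE', hlt⟩ := hmin
    obtain ⟨c, H, hH, h1, h2⟩ := hE.exists_C_dvd (O := O) hg hw hπ hπ0 hE' hlt
    exact hE.exists_points hπ hprime hH h1 h2
  · rintro ⟨p₀, hp, E₁, hE₁, q₀, hq⟩ hmin
    obtain ⟨⟨E₂, hE₂, hpt⟩, hΔ⟩ := moreover p₀ E₁ q₀ hp hE₁ hq
    have hAO : Function.Injective (algebraMap A O) :=
      IsLocalization.injective O 𝔭.primeCompl_le_nonZeroDivisors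
    exact absurd (hmin (E₂.baseChange O hAO) (hpt.baseChange hAO)) (not_le.mpr
      (Hyperelliptic.WeierstrassEquation.emultiplicity_baseChange_lt hg hπ hπ0 (hΔ E₂ hE₂) hAO))
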